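/- **Setting.** Let $(X,d)$ be a nonempty compact metric space and $T:X\to X$ Lipschitz. Let $\mathcal M(X,T)$ be the set of $T$-invariant Borel probability measures. For continuous $u:X\to\mathbb R$ and $\psi:X\to(0,\infty)$ put $$\beta(u;X,T)=\min_{\nu\in\mathcal M(X,T)}\int u\,d\nu,\qquad \beta(u;\psi,X,T)=\min_{\nu\in\mathcal M(X,T)}\frac{\int u\,d\nu}{\int\psi\,d\nu};$$ a measure $\nu\in\mathcal M(X,T)$ attaining the second minimum is called $(u,\psi)$-minimizing. For $0<\alpha\le 1$ let $\mathcal C^{0,\alpha}(X)$ be the space of $\alpha$-Hölder functions $u:X\to\mathbb R$ with the norm $\sup_x|u(x)|+\sup_{x\ne y}|u(x)-u(y)|/d(x,y)^\alpha$. Assume the following two properties. **(ASP)** There are constants $\lambda,\delta,C,L>0$ such that: 1. if $n\in\mathbb N$ and $x,y\in X$ satisfy $d(T^ix,T^iy)\le\delta$ for $0\le i\le n$, then $d(T^kx,T^ky)\le Ce^{-\lambda\min(k,n-k)}\bigl(d(x,y)+d(T^nx,T^ny)\bigr)$ for $0\le k\le n$; 2. if $0\le\eta\le\delta$, $n\ge1$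 and $x_0,\dots,x_{n-1}\in X$ satisfy $d(x_{i+1},Tx_i)\le\eta$ for $0\le i\le n-1$ (indices modulo $n$), then there is a periodic point $x$ of $T$ whose period divides $n$ with $d(x_i,T^ix)\le L\eta$ for $0\le i\le n-1$. **(MCGBP)** For every $0<\alpha\le1$ there is an integer $K\ge1$ such that for every $u\in\mathcal C^{0,\alpha}(X)$ there is $v\in\mathcal C^{0,\alpha}(X)$ with $$\frac1K\sum_{i=0}^{K-1}u\circ T^i-v\circ T^K+v-\beta(u;X,T)\ge0\quad\text{on }X.$$ **Theorem.** Let $(X,T)$ be as above and let $\psi:X\to(0,\infty)$ be continuous. (I) Let $\alpha\in(0,1]$. If $\psi\in\mathcal C^{0,\alpha}(X)$, then there is an open dense set $\mathfrak P\subset\mathcal C^{0,\alpha}(X)$ such that for every $u\in\mathfrak P$ there is exactly one $(u,\psi)$-minimizing measure, and it is supported on a periodic orbit of $T$. (II) Let $M$ be a compact $C^\infty$ Riemannian manifold (without boundary) with its Riemannian distance. (If $M$ is disconnected, take any metric inducing the topology of $M$ that equals the Riemannian distance on each connected component.) Let $f:M\to M$ be continuous, and suppose that $X\subset M$ carries the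 induced metric, that $f(X)\subset X$ and $T=f|_X$, and that $\psi$ is the restriction to $X$ of a Lipschitz function $\psi:M\to\mathbb R$. Let $\mathcal C^{1,0}(M)$ be the space of continuously differentiable functions $u:M\to\mathbb R$ with the norm $\sup_x|u(x)|+\sup_x\|D_xu\|$. Then there is an open dense set $\mathfrak P\subset\mathcal C^{1,0}(M)$ such that for every $u\in\mathfrak P$ there is exactly one $(u|_X,\psi|_X)$-minimizing measure of $(X,T)$, and it is supported on a periodic orbit of $T$. -/

import Mathlib

open MeasureTheory
open scoped Manifold ContDiff Bundle NNReal

noncomputable section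

namespace ErgOpt

/-! ### Invariant measures and ratio minimization -/

section Measures

variable {X : Type*} [MeasurableSpace X]

/-- `M(X, T)`: the `T`-invariant probability measures on `X` (with `X` carrying its Borel
sigma-algebra and `T` continuous wherever this is used). -/
def invariantMeasures (T : X → X) : Set (Measure X) :=
  {ν | IsProbabilityMeasure ν ∧ MeasurePreserving T ν ν}

/-- `β(u; X, T)`, the minimum of `∫ u dν` over the invariant probability measures `ν`. -/
def minErgodicAverage (T : X → X) (u : X → ℝ) : ℝ :=
  sInf ((fun ν : Measure X => ∫ x, u x ∂ν) '' invariantMeasures T)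

/-- `β(u; ψ, X, T)`, the ratio minimum ergodic average: the minimum of `∫ u dν / ∫ ψ dν` over the
invariant probability measures `ν`. -/
def ratioMinErgodicAverage (T : X → X) (u ψ : X → ℝ) : ℝ :=
  sInf ((fun ν : Measure X => (∫ x, u x ∂ν) / ∫ x, ψ x ∂ν) '' invariantMeasures T)

/-- The set of `(u, ψ)`-minimizing measures of `(X, T)`. -/
def minimizingMeasures (T : X → X) (u ψ : X → ℝ) : Set (Measure X) :=
  {ν | ν ∈ invariantMeasures T ∧
    (∫ x, u x ∂ν) / (∫ x, ψ x ∂ν) = ratioMinErgodicAverage T u ψ}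

/-- There is exactly one `(u, ψ)`-minimizing measure, and it is supported on a periodic orbit
of `T` (it gives no mass to the complement of this finite set). -/
def UniquelyPeriodicallyMinimized (T : X → X) (u ψ : X → ℝ) : Prop :=
  ∃ ν : Measure X, minimizingMeasures T u ψ = {ν} ∧
    ∃ x ∈ Function.periodicPts T, ν (Set.range fun k : ℕ => T^[k] x)ᶜ = 0

end Measures

/-! ### The hypotheses on the dynamical system -/

section Systems

variable {X : Type*} [MetricSpace X]

/-- `x 0, …, x (n - 1)` is a periodic `η`-pseudo-orbit: `x (i + 1)` is within `η` of `T (x i)`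
for all `i < n`, indices being taken modulo `n`. -/
def IsPeriodicPseudoOrbit (T : X → X) (η : ℝ) (n : ℕ) (x : ℕ → X) : Prop :=
  ∀ i < n, dist (x ((i + 1) % n)) (T (x i)) ≤ η

/-- The Anosov shadowing property (ASP). -/
def AnosovShadowing (T : X → X) : Prop :=
  ∃ lam δ C L : ℝ, 0 < lam ∧ 0 < δ ∧ 0 < C ∧ 0 < L ∧
    (∀ (n : ℕ) (x y : X), (∀ i ≤ n, dist (T^[i] x) (T^[i] y) ≤ δ) →
      ∀ k ≤ n, dist (T^[k] x) (T^[k] y) ≤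
        C * Real.exp (-lam * (min k (n - k) : ℕ)) * (dist x y + dist (T^[n] x) (T^[n] y))) ∧
    (∀ (η : ℝ) (n : ℕ) (x : ℕ → X), 0 ≤ η → η ≤ δ → 1 ≤ n → IsPeriodicPseudoOrbit T η n x →
      ∃ z ∈ Function.periodicPts T, Function.minimalPeriod T z ∣ n ∧
        ∀ i < n, dist (x i) (T^[i] z) ≤ L * η)

/-- The Mañé–Conze–Guivarc'h–Bousch property (MCGBP). Here `birkhoffAverage ℝ T u K` is
`u_K = (1 / K) ∑_{i < K} u ∘ T^i`. -/
def ManeConzeGuivarchBousch [MeasurableSpace X] (T : X → X) : Prop :=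
  ∀ α : ℝ≥0, 0 < α → α ≤ 1 → ∃ K : ℕ, 0 < K ∧
    ∀ u : X → ℝ, MemHolder α u → ∃ v : X → ℝ, MemHolder α v ∧
      ∀ x, 0 ≤ birkhoffAverage ℝ T u K x - v (T^[K] x) + v x - minErgodicAverage T u

/-- The standing assumptions on `(X, T, ψ)`, apart from `X` being a nonempty compact metric
space. -/
structure IsAdmissible [MeasurableSpace X] (T : X → X) (ψ : X → ℝ) : Prop where
  lipschitz : ∃ κ : ℝ≥0, LipschitzWith κ T
  asp : AnosovShadowing T
  mcgbp : ManeConzeGuivarchBousch T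
  continuous_weight : Continuous ψ
  weight_pos : ∀ x, 0 < ψ x

end Systems

/-! ### The space of `α`-Hölder functions -/

section Holder

variable (X : Type*) [MetricSpace X] [CompactSpace X] (α : ℝ≥0)

/-- The `α`-Hölder functions as a linear subspace of the continuous functions. -/
def holderSubmodule : Submodule ℝ C(X, ℝ) where
  carrier := {u | MemHolder α u}
  add_mem' hu hv := MemHolder.add hu hv
  zero_mem' := memHolder_zero
  smul_mem' _ _ hu := MemHolder.smul hu

/-- `C^{0,α}(X)`. It is not reducible to the subspace of `C(X, ℝ)`, since it carries the Hölder norm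
and not the sup norm. -/
def HolderSpace : Type _ := holderSubmodule X α

instance : AddCommGroup (HolderSpace X α) := inferInstanceAs (AddCommGroup (holderSubmodule X α))

instance : Module ℝ (HolderSpace X α) := inferInstanceAs (Module ℝ (holderSubmodule X α))

variable {X α}

/-- The underlying continuous function. -/
def HolderSpace.toC (u : HolderSpace X α) : C(X, ℝ) := (show holderSubmodule X α from u).1

instance : CoeFun (HolderSpace X α) (fun _ => X → ℝ) := ⟨fun u => u.toC⟩

set_option linter.unusedSectionVars false

theorem HolderSpace.memHolder (u : HolderSpace X α) : MemHolder α u :=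
  (show holderSubmodule X α from u).2

/-- The Hölder norm `sup |u| + [u]_α`, where `[u]_α` is the least `α`-Hölder constant of `u`. -/
instance : Norm (HolderSpace X α) := ⟨fun u => ‖u.toC‖ + (nnHolderNorm α u : ℝ)⟩

theorem HolderSpace.norm_def (u : HolderSpace X α) :
    ‖u‖ = ‖u.toC‖ + (nnHolderNorm α u : ℝ) := rfl

theorem HolderSpace.core : NormedSpace.Core ℝ (HolderSpace X α) where
  norm_nonneg u := by rw [HolderSpace.norm_def]; positivity
  norm_smul c u := by
    have h1 : (c • u).toC = c • u.toC := rfl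
    have h2 : nnHolderNorm α (c • u) = ‖c‖₊ * nnHolderNorm α u := by
      rw [h1]; exact u.memHolder.nnHolderNorm_smul c
    rw [HolderSpace.norm_def, HolderSpace.norm_def, h2, h1, norm_smul]
    push_cast
    ring
  norm_triangle u v := by
    have h1 : (u + v).toC = u.toC + v.toC := rfl
    have h2 : (nnHolderNorm α (u + v) : ℝ) ≤ nnHolderNorm α u + nnHolderNorm α v := by
      rw [h1]; exact_mod_cast u.memHolder.nnHolderNorm_add_le v.memHolder
    rw [HolderSpace.norm_def, HolderSpace.norm_def, HolderSpace.norm_def, h1] at *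
    linarith [norm_add_le u.toC v.toC]
  norm_eq_zero_iff u := by
    constructor
    · intro h
      have h0 : ‖u.toC‖ = 0 := by
        rw [HolderSpace.norm_def] at h
        have := norm_nonneg u.toC
        have := (nnHolderNorm α u).2
        linarith
      exact Subtype.ext (norm_eq_zero.1 h0)
    · rintro rfl
      have h1 : (0 : HolderSpace X α).toC = 0 := rfl
      rw [HolderSpace.norm_def, h1]
      simp

instance : NormedAddCommGroup (HolderSpace X α) := NormedAddCommGroup.ofCore HolderSpace.core

end Holder

/-! ### The space of `C^1` functions on a compact Riemannian manifold -/

section COne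

variable {n : ℕ} {M : Type*} [TopologicalSpace M] [ChartedSpace (EuclideanSpace ℝ (Fin n)) M]

/-- The differential `D_x u : T_x M → ℝ`. -/
def differential (n : ℕ) {M : Type*} [TopologicalSpace M]
    [ChartedSpace (EuclideanSpace ℝ (Fin n)) M] (u : M → ℝ) (x : M) :
    TangentSpace (𝓡 n) x →L[ℝ] ℝ :=
  mfderiv (𝓡 n) 𝓘(ℝ, ℝ) u x

/-- The `C^1` functions as a linear subspace of the continuous functions. -/
def cOneSubmodule (n : ℕ) (M : Type*) [TopologicalSpace M]
    [ChartedSpace (EuclideanSpace ℝ (Fin n)) M] : Submodule ℝ C(M, ℝ) where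
  carrier := {u | ContMDiff (𝓡 n) 𝓘(ℝ, ℝ) 1 u}
  add_mem' hu hv := ContMDiff.add hu hv
  zero_mem' := contMDiff_const
  smul_mem' c u hu := by
    have h : ContMDiff (𝓡 n) 𝓘(ℝ, ℝ) 1 (fun _ : M => c) := contMDiff_const
    exact h.smul hu

/-- `C^{1,0}(M)`, the continuously differentiable functions on the `n`-dimensional manifold `M`. -/
def COneSpace (n : ℕ) (M : Type*) [TopologicalSpace M]
    [ChartedSpace (EuclideanSpace ℝ (Fin n)) M] : Type _ := cOneSubmodule n M

instance : AddCommGroup (COneSpace n M) := inferInstanceAs (AddCommGroup (cOneSubmodule n M))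

instance : Module ℝ (COneSpace n M) := inferInstanceAs (Module ℝ (cOneSubmodule n M))

/-- The underlying continuous function. -/
def COneSpace.toC (u : COneSpace n M) : C(M, ℝ) := (show cOneSubmodule n M from u).1

instance : CoeFun (COneSpace n M) (fun _ => M → ℝ) := ⟨fun u => u.toC⟩

theorem COneSpace.contMDiff (u : COneSpace n M) : ContMDiff (𝓡 n) 𝓘(ℝ, ℝ) 1 u :=
  (show cOneSubmodule n M from u).2

theorem COneSpace.differential_add (u v : COneSpace n M) (x : M) :
    differential n (u + v) x = differential n u x + differential n v x :=
  mfderiv_add (u.contMDiff.mdifferentiable one_ne_zero x)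
    (v.contMDiff.mdifferentiable one_ne_zero x)

theorem COneSpace.differential_smul (c : ℝ) (u : COneSpace n M) (x : M) :
    differential n (c • u) x = c • differential n u x :=
  const_smul_mfderiv (u.contMDiff.mdifferentiable one_ne_zero x) c

variable [Bundle.RiemannianBundle (fun x : M => TangentSpace (𝓡 n) x)]

section Bounded

variable [IsManifold (𝓡 n) ∞ M] [IsContMDiffRiemannianBundle (𝓡 n) ∞
    (EuclideanSpace ℝ (Fin n)) (fun x : M => TangentSpace (𝓡 n) x)]

theorem isContinuousRiemannianBundle : IsContinuousRiemannianBundle (EuclideanSpace ℝ (Fin n))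
    (fun x : M => TangentSpace (𝓡 n) x) := by
  obtain ⟨g, hg, h⟩ := IsContMDiffRiemannianBundle.exists_contMDiff (IB := 𝓡 n) (n := ∞)
    (F := EuclideanSpace ℝ (Fin n)) (E := fun x : M => TangentSpace (𝓡 n) x)
  exact ⟨g, hg.continuous, h⟩

theorem COneSpace.locally_bounded (u : COneSpace n M) (p : M) :
    ∃ C : ℝ, ∀ᶠ y in nhds p, ‖differential n u y‖ ≤ C := by
  have : IsContinuousRiemannianBundle (EuclideanSpace ℝ (Fin n))
    (fun x : M => TangentSpace (𝓡 n) x) := isContinuousRiemannianBundle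
  obtain ⟨C, hC0, hC⟩ := eventually_norm_trivializationAt_lt (EuclideanSpace ℝ (Fin n))
    (fun x : M => TangentSpace (𝓡 n) x) p
  obtain ⟨D, hD⟩ : ∃ D : ℝ, ∀ᶠ y in nhds p, ‖inTangentCoordinates (𝓡 n) 𝓘(ℝ, ℝ) id u
      (mfderiv (𝓡 n) 𝓘(ℝ, ℝ) u) p y‖ < D :=
    ⟨_, ((u.contMDiff p).mfderiv_const (m := 0) (by simp)).continuousAt.norm.eventually
      (gt_mem_nhds (lt_add_one _))⟩
  refine ⟨D * C, ?_⟩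
  filter_upwards [hC, hD, chart_source_mem_nhds (EuclideanSpace ℝ (Fin n)) p] with y hy h2y h3y
  have hD0 : 0 ≤ D := (norm_nonneg _).trans h2y.le
  refine ContinuousLinearMap.opNorm_le_bound _ (by positivity) fun v => ?_
  set e := trivializationAt (EuclideanSpace ℝ (Fin n)) (fun x : M => TangentSpace (𝓡 n) x) p
  set Φ := inTangentCoordinates (𝓡 n) 𝓘(ℝ, ℝ) id u (mfderiv (𝓡 n) 𝓘(ℝ, ℝ) u) p y with hΦ
  have hb : y ∈ e.baseSet := h3y
  have h4 : e.symmL ℝ y (e.continuousLinearMapAt ℝ y v) = v := e.symmL_continuousLinearMapAt hb v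
  have h5 : differential n u y v = Φ (e.continuousLinearMapAt ℝ y v) := by
    simp only [hΦ, inTangentCoordinates, ContinuousLinearMap.inCoordinates,
      TangentBundle.continuousLinearMapAt_model_space]
    change _ = differential n u y (e.symmL ℝ y (e.continuousLinearMapAt ℝ y v))
    rw [h4]
  rw [h5]
  calc
    _ ≤ ‖Φ‖ * ‖e.continuousLinearMapAt ℝ y v‖ := ContinuousLinearMap.le_opNorm _ _
    _ ≤ D * (C * ‖v‖) := by
        gcongr
        exact (ContinuousLinearMap.le_opNorm _ _).trans (by gcongr)
    _ = _ := by ring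

variable [CompactSpace M]

theorem COneSpace.bddAbove (u : COneSpace n M) :
    BddAbove (Set.range fun x => ‖differential n u x‖) := by
  choose C hC using u.locally_bounded
  obtain ⟨t, -, ht⟩ := isCompact_univ.elim_nhds_subcover (fun p => {y : M | ‖differential n u y‖ ≤ C p})
    (fun p _ => hC p)
  obtain ⟨B, hB⟩ := (t.image C).bddAbove
  refine ⟨B, ?_⟩
  rintro _ ⟨x, rfl⟩
  obtain ⟨p, hp, hx⟩ := Set.mem_iUnion₂.1 (ht (Set.mem_univ x))
  exact le_trans hx (hB (by simpa using ⟨p, hp, rfl⟩))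

/-- The `C^1` norm `sup |u| + sup_x ‖D_x u‖`, where `‖D_x u‖` is the operator norm for the Riemannian
inner product on `T_x M`. -/
instance : Norm (COneSpace n M) := ⟨fun u => ‖u.toC‖ + ⨆ x, ‖differential n u x‖⟩

theorem COneSpace.norm_def (u : COneSpace n M) :
    ‖u‖ = ‖u.toC‖ + ⨆ x, ‖differential n u x‖ := rfl

theorem COneSpace.norm_differential_smul (c : ℝ) (u : COneSpace n M) (x : M) :
    ‖differential n (c • u) x‖ = ‖c‖ * ‖differential n u x‖ := by
  have key : ∀ (c : ℝ) (u : COneSpace n M),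
      ‖differential n (c • u) x‖ ≤ ‖c‖ * ‖differential n u x‖ := fun c u => by
    rw [COneSpace.differential_smul]
    exact ContinuousLinearMap.opNorm_smul_le _ _
  refine le_antisymm (key c u) ?_
  rcases eq_or_ne c 0 with rfl | hc
  · rw [norm_zero, zero_mul]
    exact ContinuousLinearMap.opNorm_nonneg _
  · have := key c⁻¹ (c • u)
    rw [inv_smul_smul₀ hc, norm_inv] at this
    rwa [← le_inv_mul_iff₀ (norm_pos_iff.2 hc)]

theorem COneSpace.core : NormedSpace.Core ℝ (COneSpace n M) where
  norm_nonneg u := by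
    rw [COneSpace.norm_def]
    exact add_nonneg (norm_nonneg _) (Real.iSup_nonneg fun x => ContinuousLinearMap.opNorm_nonneg _)
  norm_smul c u := by
    have h1 : (c • u).toC = c • u.toC := rfl
    rw [COneSpace.norm_def, COneSpace.norm_def, mul_add, Real.mul_iSup_of_nonneg (norm_nonneg c),
      h1, norm_smul]
    congr 2
    funext x
    exact COneSpace.norm_differential_smul c u x
  norm_triangle u v := by
    have h1 : (u + v).toC = u.toC + v.toC := rfl
    have h2 : ⨆ x, ‖differential n (u + v) x‖ ≤
        (⨆ x, ‖differential n u x‖) + ⨆ x, ‖differential n v x‖ := by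
      refine Real.iSup_le (fun x => ?_) (add_nonneg (Real.iSup_nonneg fun x => ContinuousLinearMap.opNorm_nonneg _)
        (Real.iSup_nonneg fun x => ContinuousLinearMap.opNorm_nonneg _))
      rw [COneSpace.differential_add]
      exact (ContinuousLinearMap.opNorm_add_le _ _).trans (add_le_add (le_ciSup u.bddAbove x) (le_ciSup v.bddAbove x))
    have h3 : ‖(u + v).toC‖ ≤ ‖u.toC‖ + ‖v.toC‖ := by rw [h1]; exact norm_add_le _ _
    rw [COneSpace.norm_def, COneSpace.norm_def, COneSpace.norm_def]
    linarith
  norm_eq_zero_iff u := by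
    constructor
    · intro h
      have h0 : ‖u.toC‖ = 0 := by
        rw [COneSpace.norm_def] at h
        have := norm_nonneg u.toC
        have : 0 ≤ ⨆ x, ‖differential n u x‖ := Real.iSup_nonneg fun x => ContinuousLinearMap.opNorm_nonneg _
        linarith
      exact Subtype.ext (norm_eq_zero.1 h0)
    · rintro rfl
      have h1 : ∀ x, differential n ((0 : COneSpace n M) : M → ℝ) x = 0 := fun x => by
        simpa using COneSpace.differential_smul 0 (0 : COneSpace n M) x
      have h2 : (0 : COneSpace n M).toC = 0 := rfl
      have h3 : ∀ x, ‖differential n ((0 : COneSpace n M) : M → ℝ) x‖ = 0 := fun x => by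
        rw [h1]; exact ContinuousLinearMap.opNorm_zero
      rw [COneSpace.norm_def]
      simp only [h3]
      simp [h2]

instance : NormedAddCommGroup (COneSpace n M) := NormedAddCommGroup.ofCore COneSpace.core

end Bounded

/-- The distance of `M` is a Riemannian distance: it is the infimum of the lengths of the `C^1`
paths between two points, for any two points that can be joined by such a path. If `M` is
connected this says that `M` is a Riemannian manifold with its geodesic distance. For points in
different connected components, where that infimum is infinite, the (finite) distance is
unrestricted, apart from being a distance that induces the topology of `M`. -/
def HasRiemannianDist (n : ℕ) (M : Type*) [MetricSpace M]
    [ChartedSpace (EuclideanSpace ℝ (Fin n)) M]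
    [Bundle.RiemannianBundle (fun x : M => TangentSpace (𝓡 n) x)] : Prop :=
  ∀ x y : M, Manifold.riemannianEDist (𝓡 n) x y ≠ ⊤ →
    edist x y = Manifold.riemannianEDist (𝓡 n) x y

end COne

end ErgOpt

end

/-! Let β be the ratio minimum. Then u − βψ has nonnegative integrals against invariant measures,
with infimum 0. By (MCGBP), up to a Birkhoff average and a coboundary, neither of which changes
these integrals, it is a Hölder function G ≥ 0; compactness gives an orbit along which G vanishes
(`IsAdmissible.exists_nonneg_cohomologous`). Let Z be the compact forward invariant set of points
whose orbits stay in {G = 0}.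

Adding roughly ε·d(·,O)^α to u should make a periodic orbit O near Z the winner. The cost of O is
the sum of G over it, at most a constant times S = ∑ d(T^k z, Z)^α; the gain of other orbits'
penalties is limited by the gap D between distinct points of O. So O is needed with S ≤ s, s small,
and D^α = P·s for a prescribed P; this is `AnosovShadowing.exists_separated_orbit`. It starts from
`AnosovShadowing.exists_periodic_near`: itineraries of length n in Z are the vertices of a digraph,
and counting paths forces a cycle of subexponentially many blocks; matching windows of length n are
exponentially close at their midpoints, so shadowing the cycle beats every power of the period. If
two distinct points of the orbit are closer than D, the shorter arc between them is closed up by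
shadowing. The period at least halves while s grows by a factor below 2^k, so s·q^k does not
increase, and the procedure stops because periods decrease.

For a separated orbit, `exists_le_birkhoffSum` bounds below the Birkhoff sums of the perturbed,
renormalized function. Its integrals are then nonnegative, which makes O uniquely minimizing.
`IsAdmissible.exists_orbit_uniquely_minimizing` leaves a margin c > 0 in the perturbation, and this
margin gives openness. It also makes the C^1 case possible: d(·,O) is replaced by a mollified
distance in a Euclidean embedding, with C^1 norm bounded independently of O and an error chosen
after c. -/

namespace ErgOpt

/-! ### Counting itineraries and closed chains of words. -/

section Words

open Filter Topology Set

/-- In a digraph on a finite vertex set `S`, a family of more than `S.card.choose ℓ` paths with `ℓ`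
vertices contains a path with a backward edge. -/
theorem exists_back_edge {V : Type*} [DecidableEq V] (E : V → V → Prop) (S : Finset V) (ℓ : ℕ)
    (A : Finset (Fin ℓ → V)) (hS : ∀ p ∈ A, ∀ i, p i ∈ S)
    (hE : ∀ p ∈ A, ∀ i j : Fin ℓ, (j : ℕ) = i + 1 → E (p i) (p j))
    (hcard : S.card.choose ℓ < A.card) :
    ∃ p ∈ A, ∃ a b : Fin ℓ, a ≤ b ∧ E (p b) (p a) := by
  by_contra! hno
  have hinj : ∀ p ∈ A, Function.Injective p := by
    -- If `p a = p b`, the edge leaving position `b - 1` ends at `p a` and is backward.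
    have key : ∀ p ∈ A, ∀ a b : Fin ℓ, a < b → p a ≠ p b := by
      intro p hp a b hab heq
      have h1 : (a : ℕ) < b := hab
      have hb : (b : ℕ) - 1 < ℓ := by have := b.2; omega
      refine hno p hp a ⟨b - 1, hb⟩ (by rw [Fin.le_def]; simp only; omega) ?_
      rw [heq]
      exact hE p hp _ _ (by simp only; omega)
    intro p hp a b hab
    rcases lt_trichotomy a b with h | h | h
    · exact (key p hp a b h hab).elim
    · exact h
    · exact (key p hp b a h hab.symm).elim
  have hmaps : ∀ p ∈ A, Finset.univ.image p ∈ S.powersetCard ℓ := by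
    intro p hp
    rw [Finset.mem_powersetCard]
    refine ⟨fun v hv => ?_, ?_⟩
    · obtain ⟨i, -, rfl⟩ := Finset.mem_image.1 hv
      exact hS p hp i
    · rw [Finset.card_image_of_injective _ (hinj p hp), Finset.card_univ, Fintype.card_fin]
  have hle : A.card ≤ (S.powersetCard ℓ).card := by
    refine Finset.card_le_card_of_injOn (fun p => Finset.univ.image p) hmaps ?_
    intro p hp p' hp' heq
    simp only at heq
    have hσ : ∀ i, ∃ j, p j = p' i := by
      intro i
      have : p' i ∈ Finset.univ.image p := by
        rw [heq]; exact Finset.mem_image_of_mem _ (Finset.mem_univ _)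
      obtain ⟨j, -, hj⟩ := Finset.mem_image.1 this
      exact ⟨j, hj⟩
    choose σ hσ using hσ
    have hσinj : Function.Injective σ := fun i j hij => hinj p' hp' (by rw [← hσ, ← hσ, hij])
    -- A descent of `σ` would make an edge of `p'` a backward edge of `p`. Hence a path without
    -- backward edges is determined by its vertex set.
    have hmono : StrictMono σ := by
      cases ℓ with
      | zero => exact fun i => i.elim0
      | succ m =>
        rw [Fin.strictMono_iff_lt_succ]
        intro i
        by_contra! hlt
        refine hno p hp _ _ hlt ?_
        rw [hσ, hσ]
        exact hE p' hp' _ _ (by simp)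
    have hid : σ = id := (hmono.range_inj strictMono_id).1 (by
      rw [(Finite.surjective_of_injective hσinj).range_eq, Set.range_id])
    funext i
    rw [← hσ i, hid, id]
  rw [Finset.card_powersetCard] at hle
  omega

variable {X : Type*} {N : ℕ}

/-- The itinerary of length `n` of `x` with respect to the colouring `c`. -/
def word (T : X → X) (c : X → Fin N) (n : ℕ) (x : X) : Fin n → Fin N := fun i => c (T^[i] x)

/-- The number of itineraries of length `n` realised in `Z`. -/
noncomputable def wordCount (T : X → X) (c : X → Fin N) (Z : Set X) (n : ℕ) : ℕ := (word T c n '' Z).ncard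

theorem wordCount_pos (T : X → X) (c : X → Fin N) {Z : Set X} (hZ : Z.Nonempty) (n : ℕ) :
    0 < wordCount T c Z n :=
  (Set.ncard_pos (Set.toFinite _)).2 (hZ.image _)

theorem iterate_mem {T : X → X} {Z : Set X} (hT : MapsTo T Z Z) {x : X} (hx : x ∈ Z) (n : ℕ) :
    T^[n] x ∈ Z := hT.iterate n hx

theorem wordCount_add_le {T : X → X} (c : X → Fin N) {Z : Set X} (hT : MapsTo T Z Z) (m n : ℕ) :
    wordCount T c Z (m + n) ≤ wordCount T c Z m * wordCount T c Z n := by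
  have hsub : word T c (m + n) '' Z ⊆
      (fun q : (Fin m → Fin N) × (Fin n → Fin N) => Fin.append q.1 q.2) ''
        ((word T c m '' Z) ×ˢ (word T c n '' Z)) := by
    rintro _ ⟨x, hx, rfl⟩
    refine ⟨(word T c m x, word T c n (T^[m] x)),
      ⟨mem_image_of_mem _ hx, mem_image_of_mem _ (iterate_mem hT hx m)⟩, ?_⟩
    funext i
    refine Fin.addCases (fun i => ?_) (fun i => ?_) i
    · simp [word]
    · simp [word, ← Function.iterate_add_apply, add_comm]
  unfold wordCount
  refine (Set.ncard_le_ncard hsub (Set.toFinite _)).trans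
    ((Set.ncard_image_le (Set.toFinite _)).trans ?_)
  rw [Set.ncard_prod]

theorem wordCount_mul_le (T : X → X) (c : X → Fin N) (Z : Set X) (ℓ n : ℕ) :
    wordCount T c Z (ℓ * n) ≤
      ((fun x => fun j : Fin ℓ => word T c n (T^[j * n] x)) '' Z).ncard := by
  have hsub : word T c (ℓ * n) '' Z ⊆
      (fun (p : Fin ℓ → Fin n → Fin N) => fun i : Fin (ℓ * n) =>
        p (finProdFinEquiv.symm i).1 (finProdFinEquiv.symm i).2) ''
      ((fun x => fun j : Fin ℓ => word T c n (T^[j * n] x)) '' Z) := by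
    rintro _ ⟨x, hx, rfl⟩
    refine ⟨_, mem_image_of_mem _ hx, ?_⟩
    funext i
    obtain ⟨q, rfl⟩ := finProdFinEquiv.surjective i
    simp only [Equiv.symm_apply_apply, word, ← Function.iterate_add_apply, finProdFinEquiv_apply_val]
    rw [mul_comm n]
  exact (Set.ncard_le_ncard hsub (Set.toFinite _)).trans (Set.ncard_image_le (Set.toFinite _))

/-- By Fekete's lemma the exponential growth rate h of the counts is an infimum, so long words
number at least e^{hℓn}, while words of length n number fewer than e^{(h+ε)n}. The factorial in the
binomial coefficient compensates for e^{εn} once ℓ is of that order. -/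
theorem eventually_choose_lt_wordCount {T : X → X} (c : X → Fin N) {Z : Set X} (hZ : Z.Nonempty)
    (hT : MapsTo T Z Z) {ε : ℝ} (hε : 0 < ε) :
    ∀ᶠ n : ℕ in atTop, ∃ ℓ : ℕ, (ℓ : ℝ) ≤ 4 * Real.exp (ε * n) ∧
      (wordCount T c Z n).choose ℓ < wordCount T c Z (ℓ * n) := by
  set u : ℕ → ℝ := fun n => Real.log (wordCount T c Z n) with hu
  have hpos : ∀ n, (0 : ℝ) < wordCount T c Z n := fun n => by
    exact_mod_cast wordCount_pos T c hZ n
  have hsub : Subadditive u := by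
    intro m n
    simp only [hu]
    rw [← Real.log_mul (hpos m).ne' (hpos n).ne']
    exact Real.log_le_log (hpos _) (by exact_mod_cast wordCount_add_le c hT m n)
  have hbdd : BddBelow (range fun n => u n / n) := by
    refine ⟨0, ?_⟩
    rintro _ ⟨n, rfl⟩
    have : 0 ≤ u n := Real.log_nonneg (by exact_mod_cast wordCount_pos T c hZ n)
    positivity
  set h := hsub.lim
  have hlim := hsub.tendsto_lim hbdd
  filter_upwards [hlim.eventually (gt_mem_nhds (lt_add_of_pos_right h hε)), eventually_gt_atTop 0]
    with n hn hn0
  have hn0' : (0 : ℝ) < n := by exact_mod_cast hn0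
  have hWn : (wordCount T c Z n : ℝ) < Real.exp (h * n) * Real.exp (ε * n) := by
    rw [div_lt_iff₀ hn0'] at hn
    rw [← Real.exp_add, ← Real.log_lt_iff_lt_exp (hpos n)]
    linarith
  -- The binomial coefficient is at most (eW/ℓ)^ℓ, where W is the number of words of length n; thus
  -- ℓ > e·e^{εn} suffices.
  set ℓ := ⌊Real.exp 1 * Real.exp (ε * n)⌋₊ + 1
  have hℓ : Real.exp 1 * Real.exp (ε * n) < ℓ := by
    simpa [ℓ] using Nat.lt_floor_add_one (Real.exp 1 * Real.exp (ε * n))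
  have hℓ0 : (0 : ℝ) < ℓ := lt_trans (by positivity) hℓ
  refine ⟨ℓ, ?_, ?_⟩
  · have h1 : (ℓ : ℝ) ≤ Real.exp 1 * Real.exp (ε * n) + 1 := by
      simp only [ℓ, Nat.cast_add, Nat.cast_one]
      gcongr
      exact Nat.floor_le (by positivity)
    have h2 : 1 ≤ Real.exp (ε * n) := Real.one_le_exp (by positivity)
    have h3 := Real.exp_one_lt_d9
    nlinarith
  · have hlow : Real.exp (h * n) ^ ℓ ≤ wordCount T c Z (ℓ * n) := by
      have hne : ℓ * n ≠ 0 := by positivity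
      have h1 := hsub.lim_le_div hbdd hne
      have h2 : (0 : ℝ) < ((ℓ * n : ℕ) : ℝ) := by positivity
      rw [le_div_iff₀ h2, Real.le_log_iff_exp_le (hpos _)] at h1
      refine le_trans (le_of_eq ?_) h1
      rw [← Real.exp_nat_mul]
      congr 1
      push_cast
      ring
    have hfac : (1 : ℝ) / ℓ.factorial ≤ (Real.exp 1 / ℓ) ^ ℓ := by
      have h1 := Real.pow_div_factorial_le_exp (ℓ : ℝ) hℓ0.le ℓ
      rw [div_pow, ← Real.exp_nat_mul, mul_one, le_div_iff₀ (by positivity)]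
      calc _ = (ℓ : ℝ) ^ ℓ / ℓ.factorial := by ring
        _ ≤ _ := h1
    have hup : ((wordCount T c Z n).choose ℓ : ℝ) < Real.exp (h * n) ^ ℓ := by
      calc ((wordCount T c Z n).choose ℓ : ℝ)
          ≤ (wordCount T c Z n : ℝ) ^ ℓ / ℓ.factorial := Nat.choose_le_pow_div _ _
        _ = (wordCount T c Z n : ℝ) ^ ℓ * (1 / ℓ.factorial) := by ring
        _ ≤ (wordCount T c Z n : ℝ) ^ ℓ * (Real.exp 1 / ℓ) ^ ℓ := by gcongr
        _ = ((wordCount T c Z n : ℝ) * (Real.exp 1 / ℓ)) ^ ℓ := by rw [mul_pow]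
        _ < Real.exp (h * n) ^ ℓ := by
          refine pow_lt_pow_left₀ ?_ (by positivity) (by simp [ℓ])
          rw [mul_div_assoc', div_lt_iff₀ hℓ0]
          calc _ < Real.exp (h * n) * Real.exp (ε * n) * Real.exp 1 := by gcongr
            _ = Real.exp (h * n) * (Real.exp 1 * Real.exp (ε * n)) := by ring
            _ < _ := by gcongr
    exact_mod_cast hup.trans_le hlow

/-- Short closed chains of itineraries in a forward invariant set. -/
theorem eventually_exists_word_return {T : X → X} (c : X → Fin N) {Z : Set X} (hZ : Z.Nonempty)
    (hT : MapsTo T Z Z) {ε : ℝ} (hε : 0 < ε) :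
    ∀ᶠ n : ℕ in atTop, ∃ b : ℕ, (b + 1 : ℝ) ≤ 4 * Real.exp (ε * n) ∧ ∃ x ∈ Z, ∃ y ∈ Z,
      word T c n (T^[b * n] x) = word T c n y ∧ word T c n (T^[n] y) = word T c n x := by
  classical
  filter_upwards [eventually_choose_lt_wordCount c hZ hT hε] with n hn
  obtain ⟨ℓ, hℓ, hlt⟩ := hn
  -- Vertices are words of length n, with an edge when some point of `Z` reads them in succession;
  -- an orbit in `Z`, read in blocks, is a path.
  set path : X → Fin ℓ → Fin n → Fin N := fun x j => word T c n (T^[j * n] x)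
  obtain ⟨p, hp, a, b, hab, y, hy, h1, h2⟩ := exists_back_edge
    (fun v v' => ∃ y ∈ Z, word T c n y = v ∧ word T c n (T^[n] y) = v')
    (Set.toFinite (word T c n '' Z)).toFinset ℓ (Set.toFinite (path '' Z)).toFinset
    (by
      intro p hp i
      obtain ⟨x, hx, rfl⟩ := (Set.Finite.mem_toFinset _).1 hp
      exact (Set.Finite.mem_toFinset _).2 (mem_image_of_mem _ (iterate_mem hT hx _)))
    (by
      intro p hp i j hij
      obtain ⟨x, hx, rfl⟩ := (Set.Finite.mem_toFinset _).1 hp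
      refine ⟨T^[i * n] x, iterate_mem hT hx _, rfl, ?_⟩
      simp only [path]
      rw [← Function.iterate_add_apply, hij]
      congr 2
      ring)
    (by
      rw [← Set.ncard_eq_toFinset_card _, ← Set.ncard_eq_toFinset_card _]
      exact hlt.trans_le (wordCount_mul_le T c Z ℓ n))
  obtain ⟨x, hx, rfl⟩ := (Set.Finite.mem_toFinset _).1 hp
  refine ⟨b - a, ?_, T^[a * n] x, iterate_mem hT hx _, y, hy, ?_, h2⟩
  · refine le_trans ?_ hℓ
    have := b.2
    exact_mod_cast (by omega : (b : ℕ) - a + 1 ≤ ℓ)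
  · rw [h1, ← Function.iterate_add_apply, ← add_mul, Nat.sub_add_cancel hab]

end Words

/-! ### Fast approximation of an invariant set by periodic orbits. -/

section Closing

open Filter Topology Set Function

variable {X : Type*} [MetricSpace X]

/-- Equal itineraries then mean orbits that stay within δ of each other, as the contraction estimate
requires. -/
theorem exists_coloring (X : Type*) [MetricSpace X] [CompactSpace X] {δ : ℝ} (hδ : 0 < δ) :
    ∃ (N : ℕ) (c : X → Fin N), ∀ x y, c x = c y → dist x y ≤ δ := by
  obtain ⟨t, -, htf, ht⟩ := finite_cover_balls_of_compact (isCompact_univ (X := X)) (half_pos hδ)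
  have : Finite t := htf
  obtain ⟨N, ⟨e⟩⟩ := Finite.exists_equiv_fin t
  have h : ∀ x : X, ∃ p : t, dist x p < δ / 2 := by
    intro x
    obtain ⟨p, hp, hx⟩ := mem_iUnion₂.1 (ht (mem_univ x))
    exact ⟨⟨p, hp⟩, hx⟩
  choose c hc using h
  refine ⟨N, fun x => e (c x), fun x y hxy => ?_⟩
  have hxy : c x = c y := e.injective hxy
  have h1 := hc x
  have h2 := hc y
  rw [← hxy] at h2
  have := dist_triangle_right x y (c x : X)
  linarith

/-- A closed chain made of an orbit segment of `x` and an orbit segment of `y` is a periodic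
pseudo-orbit. -/
theorem isPeriodicPseudoOrbit_splice {T : X → X} {x y : X} {m n : ℕ} {η : ℝ} (hn : 0 < n)
    (hη : 0 ≤ η) (h1 : dist (T^[m] x) y ≤ η) (h2 : dist (T^[n] y) x ≤ η) :
    IsPeriodicPseudoOrbit T (2 * η) (m + n)
      (fun i => if i < m then T^[i] x else T^[i - m] y) := by
  intro i hi
  have hs : ∀ (z : X) (j : ℕ), T (T^[j] z) = T^[j + 1] z := fun z j => by
    rw [iterate_succ_apply']
  rcases lt_or_ge (i + 1) (m + n) with hlt | hge
  · rw [Nat.mod_eq_of_lt hlt]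
    beta_reduce
    rcases lt_trichotomy (i + 1) m with h | h | h
    · rw [if_pos h, if_pos (by omega), hs, dist_self]
      positivity
    · rw [if_neg (by omega), if_pos (by omega), hs, h, Nat.sub_self, iterate_zero_apply, dist_comm]
      linarith
    · rw [if_neg (by omega), if_neg (by omega), hs, show i + 1 - m = i - m + 1 by omega, dist_self]
      positivity
  · have hi' : i + 1 = m + n := by omega
    rw [hi', Nat.mod_self]
    beta_reduce
    rw [if_neg (show ¬ i < m by omega), hs, show i - m + 1 = n by omega]
    -- If the first segment is empty, the two jumps merge into one; this accounts for the factor 2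
    -- in `2 * η`.
    rcases Nat.eq_zero_or_pos m with rfl | hm
    · simp only [lt_irrefl, if_false, Nat.sub_self, iterate_zero_apply] at h1 ⊢
      calc dist y (T^[n] y) ≤ dist x y + dist (T^[n] y) x := by
            rw [dist_comm x y, dist_comm (T^[n] y)]; exact dist_triangle _ _ _
        _ ≤ 2 * η := by linarith
    · rw [if_pos hm, iterate_zero_apply, dist_comm]
      linarith

/-- A forward invariant set is approximated by periodic orbits, superpolynomially fast in the
period. -/
theorem AnosovShadowing.exists_periodic_near [CompactSpace X] {T : X → X} (hT : AnosovShadowing T) {Z : Set X}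
    (hZ : Z.Nonempty) (hTZ : MapsTo T Z Z) {α : ℝ} (hα : 0 < α) (k : ℕ) {τ : ℝ} (hτ : 0 < τ) :
    ∃ z ∈ periodicPts T, ∃ η : ℝ, 0 ≤ η ∧ (∀ i, Metric.infDist (T^[i] z) Z ≤ η) ∧
      (minimalPeriod T z : ℝ) ^ k * η ^ α ≤ τ := by
  obtain ⟨lam, δ, C, L, hlam, hδ, hC, hL, hexp, hshad⟩ := hT
  obtain ⟨N, c, hc⟩ := exists_coloring X hδ
  -- With n = 2h + 1, the error to the power α decays like e^{-λαh}, that is, like e^{-2an}. The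
  -- return time has at most 4e^{an/(k+1)} blocks, so the k-th power of the period costs about n^k
  -- e^{an}; a factor e^{-an} remains.
  set a : ℝ := lam * α / 4 with ha
  have ha0 : 0 < a := by positivity
  set K : ℝ := 4 ^ k * (8 * δ * C * L) ^ α * Real.exp (2 * a) / a ^ k with hK
  have hodd : Tendsto (fun h : ℕ => 2 * h + 1) atTop atTop :=
    tendsto_atTop_mono (fun h => by simp only [id]; omega) tendsto_id
  have hlim1 : Tendsto (fun h : ℕ => K * ((a * ((2 * h + 1 : ℕ) : ℝ)) ^ k *
      Real.exp (-(a * ((2 * h + 1 : ℕ) : ℝ))))) atTop (𝓝 0) := by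
    have h1 : Tendsto (fun h : ℕ => a * ((2 * h + 1 : ℕ) : ℝ)) atTop atTop :=
      (tendsto_natCast_atTop_atTop.comp hodd).const_mul_atTop ha0
    simpa using ((Real.tendsto_pow_mul_exp_neg_atTop_nhds_zero k).comp h1).const_mul K
  have hlim2 : Tendsto (fun h : ℕ => 4 * δ * C * Real.exp (-lam * (h : ℝ))) atTop (𝓝 0) := by
    have h1 : Tendsto (fun h : ℕ => -lam * (h : ℝ)) atTop atBot :=
      tendsto_natCast_atTop_atTop.const_mul_atTop_of_neg (by linarith)
    simpa using (Real.tendsto_exp_atBot.comp h1).const_mul (4 * δ * C)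
  obtain ⟨h, ⟨b, hb, x, hx, y, hy, hxy, hyx⟩, hsmall, hη⟩ :=
    ((hodd.eventually (eventually_exists_word_return c hZ hTZ
      (show 0 < a / (k + 1) by positivity))).and ((hlim1.eventually (ge_mem_nhds hτ)).and
        (hlim2.eventually (ge_mem_nhds hδ)))).exists
  -- Odd length gives a midpoint: equal words keep two orbits δ-close on times 0, …, 2h, hence
  -- η-close at time h. The pseudo-orbit below therefore starts both segments at time h.
  set n := 2 * h + 1 with hn
  set η : ℝ := 2 * δ * C * Real.exp (-lam * (h : ℝ)) with hηdef
  have hη0 : 0 ≤ η := by positivity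
  have hclose : ∀ p q : X, word T c n p = word T c n q → dist (T^[h] p) (T^[h] q) ≤ η := by
    intro p q hpq
    have hnear : ∀ i ≤ 2 * h, dist (T^[i] p) (T^[i] q) ≤ δ := fun i hi =>
      hc _ _ (congrFun hpq ⟨i, by omega⟩)
    have h1 := hexp (2 * h) p q hnear h (by omega)
    have h2 : min h (2 * h - h) = h := by omega
    rw [h2] at h1
    have h3 := hnear 0 (by omega)
    have h4 := hnear (2 * h) le_rfl
    simp only [iterate_zero_apply] at h3
    calc _ ≤ _ := h1
      _ ≤ C * Real.exp (-lam * (h : ℝ)) * (δ + δ) := by gcongr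
      _ = η := by rw [hηdef]; ring
  have hpo : IsPeriodicPseudoOrbit T (2 * η) (b * n + n)
      (fun i => if i < b * n then T^[i] (T^[h] x) else T^[i - b * n] (T^[h] y)) := by
    refine isPeriodicPseudoOrbit_splice (by omega) hη0 ?_ ?_
    · have := hclose _ _ hxy
      rwa [← iterate_add_apply, add_comm, iterate_add_apply] at this
    · have := hclose _ _ hyx
      rwa [← iterate_add_apply, add_comm, iterate_add_apply] at this
  obtain ⟨z, hz, hdvd, hsh⟩ := hshad (2 * η) (b * n + n) _ (by positivity) (by
    rw [hηdef]; linarith) (by omega) hpo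
  refine ⟨z, hz, L * (2 * η), by positivity, ?_, ?_⟩
  · intro i
    have hper : IsPeriodicPt T (b * n + n) z :=
      (isPeriodicPt_minimalPeriod T z).trans_dvd hdvd
    rw [← hper.iterate_mod_apply i]
    have hi : i % (b * n + n) < b * n + n := Nat.mod_lt _ (by omega)
    refine (Metric.infDist_le_dist_of_mem (y := if i % (b * n + n) < b * n then
      T^[i % (b * n + n)] (T^[h] x) else T^[i % (b * n + n) - b * n] (T^[h] y)) ?_).trans ?_
    · split_ifs
      · exact iterate_mem hTZ (iterate_mem hTZ hx _) _
      · exact iterate_mem hTZ (iterate_mem hTZ hy _) _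
    · rw [dist_comm]
      exact hsh _ hi
  · have hper : (minimalPeriod T z : ℝ) ≤ 4 * Real.exp (a / (k + 1) * n) * n := by
      have h1 : minimalPeriod T z ≤ b * n + n := Nat.le_of_dvd (by omega) hdvd
      calc (minimalPeriod T z : ℝ) ≤ ((b * n + n : ℕ) : ℝ) := by exact_mod_cast h1
        _ = (b + 1 : ℝ) * n := by push_cast; ring
        _ ≤ _ := by gcongr
    have hexp1 : Real.exp (a / (k + 1) * n) ^ k ≤ Real.exp (a * n) := by
      rw [← Real.exp_nat_mul, Real.exp_le_exp]
      calc (k : ℝ) * (a / (k + 1) * n) = (k / (k + 1)) * (a * n) := by ring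
        _ ≤ 1 * (a * n) := by
          gcongr
          rw [div_le_one (by positivity)]
          linarith
        _ = a * n := one_mul _
    have hηα : (L * (2 * η)) ^ α ≤ (8 * δ * C * L) ^ α * Real.exp (-(lam * α * h)) := by
      have h1 : Real.exp (-(lam * α * h)) = Real.exp (-lam * h) ^ α := by
        rw [← Real.exp_mul]; congr 1; ring
      rw [h1, ← Real.mul_rpow (by positivity) (by positivity)]
      refine Real.rpow_le_rpow (by positivity) ?_ hα.le
      rw [hηdef]
      have : 0 ≤ δ * C * L * Real.exp (-lam * h) := by positivity
      nlinarith
    refine le_trans ?_ hsmall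
    calc (minimalPeriod T z : ℝ) ^ k * (L * (2 * η)) ^ α
        ≤ (4 * Real.exp (a / (k + 1) * n) * n) ^ k *
          ((8 * δ * C * L) ^ α * Real.exp (-(lam * α * h))) := by gcongr
      _ = 4 ^ k * n ^ k * (8 * δ * C * L) ^ α * Real.exp (-(lam * α * h)) *
          Real.exp (a / (k + 1) * n) ^ k := by rw [mul_pow, mul_pow]; ring
      _ ≤ 4 ^ k * n ^ k * (8 * δ * C * L) ^ α * Real.exp (-(lam * α * h)) *
          Real.exp (a * n) := by gcongr
      _ = 4 ^ k * n ^ k * (8 * δ * C * L) ^ α * (Real.exp (2 * a) * Real.exp (-(a * n))) := by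
          rw [mul_assoc _ (Real.exp _), ← Real.exp_add, ← Real.exp_add]
          congr 2
          rw [ha, hn]
          push_cast
          ring
      _ = K * ((a * n) ^ k * Real.exp (-(a * n))) := by
          rw [hK, mul_pow]
          field_simp

end Closing

/-! ### Periodic orbits with large gaps. -/

section Separated

open Filter Topology Set Function

theorem sum_orbit_shift {X R : Type*} [AddCommMonoid R] {T : X → X} {q : ℕ} {z : X}
    (h : IsPeriodicPt T q z) (f : X → R) (a : ℕ) :
    ∑ k ∈ Finset.range q, f (T^[k] (T^[a] z)) = ∑ k ∈ Finset.range q, f (T^[k] z) := by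
  induction a with
  | zero => rfl
  | succ a ih =>
    rw [← ih]
    have h1 : IsPeriodicPt T q (T^[a] z) := h.apply_iterate a
    have h3 : ∀ k, T^[k] (T^[a + 1] z) = T^[k + 1] (T^[a] z) := fun k => by
      rw [← iterate_add_apply, ← iterate_add_apply]; congr 1; ring
    simp only [h3]
    cases q with
    | zero => simp
    | succ q =>
      rw [Finset.sum_range_succ, Finset.sum_range_succ' _ q, h1.eq, iterate_zero_apply]

theorem sum_pow_min_le {r : ℝ} (h0 : 0 ≤ r) (h1 : r < 1) (m : ℕ) :
    ∑ k ∈ Finset.range (m + 1), r ^ min k (m - k) ≤ 2 / (1 - r) := by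
  have hg : ∑ k ∈ Finset.range (m + 1), r ^ k ≤ 1 / (1 - r) := by
    rw [geom_sum_eq h1.ne, ← neg_div_neg_eq, neg_sub, neg_sub]
    have := pow_nonneg h0 (m + 1)
    have : 0 < 1 - r := by linarith
    gcongr
    linarith
  calc ∑ k ∈ Finset.range (m + 1), r ^ min k (m - k)
      ≤ ∑ k ∈ Finset.range (m + 1), (r ^ k + r ^ (m - k)) := by
        refine Finset.sum_le_sum fun k _ => ?_
        have := pow_nonneg h0 k
        have := pow_nonneg h0 (m - k)
        rcases min_choice k (m - k) with h | h <;> rw [h] <;> linarith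
    _ = ∑ k ∈ Finset.range (m + 1), r ^ k + ∑ k ∈ Finset.range (m + 1), r ^ k := by
        rw [Finset.sum_add_distrib, ← Finset.sum_range_reflect (fun k => r ^ k) (m + 1)]
        congr 1
    _ ≤ 2 / (1 - r) := by
        rw [show (2 : ℝ) / (1 - r) = 1 / (1 - r) + 1 / (1 - r) by ring]
        linarith

variable {X : Type*} [MetricSpace X] {T : X → X}

/-- The Anosov shadowing property, with the exponential estimate summed along the orbit
segment. -/
theorem AnosovShadowing.exists_sum_le (hT : AnosovShadowing T) {α : ℝ} (hα : 0 < α) :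
    ∃ δ C L : ℝ, 0 < δ ∧ 0 < C ∧ 0 < L ∧
      (∀ (η : ℝ) (m : ℕ) (x y : X), (∀ i ≤ m, dist (T^[i] x) (T^[i] y) ≤ δ) →
        dist x y ≤ η → dist (T^[m] x) (T^[m] y) ≤ η →
        ∑ k ∈ Finset.range (m + 1), dist (T^[k] x) (T^[k] y) ^ α ≤ C * η ^ α) ∧
      (∀ (η : ℝ) (n : ℕ) (x : ℕ → X), 0 ≤ η → η ≤ δ → 1 ≤ n → IsPeriodicPseudoOrbit T η n x →
        ∃ z ∈ periodicPts T, minimalPeriod T z ∣ n ∧ ∀ i < n, dist (x i) (T^[i] z) ≤ L * η) := by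
  obtain ⟨lam, δ, C, L, hlam, hδ, hC, hL, hexp, hshad⟩ := hT
  set r := Real.exp (-(lam * α)) with hr
  have hr1 : r < 1 := by
    rw [hr, Real.exp_lt_one_iff]
    have : 0 < lam * α := by positivity
    linarith
  have hr0 : 0 < 1 - r := by linarith
  refine ⟨δ, (C * 2) ^ α * (2 / (1 - r)), L, hδ, by positivity, hL, ?_, hshad⟩
  intro η m x y hxy h0 hm
  have hη : 0 ≤ η := dist_nonneg.trans h0
  calc ∑ k ∈ Finset.range (m + 1), dist (T^[k] x) (T^[k] y) ^ α
      ≤ ∑ k ∈ Finset.range (m + 1), (C * 2) ^ α * η ^ α * r ^ min k (m - k) := by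
        refine Finset.sum_le_sum fun k hk => ?_
        have hk : k ≤ m := by have := Finset.mem_range.1 hk; omega
        have h1 := hexp m x y hxy k hk
        have h2 : r ^ min k (m - k) = Real.exp (-lam * (min k (m - k) : ℕ)) ^ α := by
          rw [hr, ← Real.exp_nat_mul, ← Real.exp_mul]; congr 1; ring
        rw [h2, ← Real.mul_rpow (by positivity) hη, ← Real.mul_rpow (by positivity) (by positivity)]
        refine Real.rpow_le_rpow dist_nonneg (h1.trans ?_) hα.le
        have : 0 ≤ C * Real.exp (-lam * (min k (m - k) : ℕ)) := by positivity
        nlinarith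
    _ = (C * 2) ^ α * η ^ α * ∑ k ∈ Finset.range (m + 1), r ^ min k (m - k) := by
        rw [Finset.mul_sum]
    _ ≤ (C * 2) ^ α * η ^ α * (2 / (1 - r)) := by
        gcongr
        exact sum_pow_min_le (Real.exp_pos _).le hr1 m
    _ = _ := by ring

/-- Two close points on a periodic orbit cut out an orbit segment of at most half the period whose
ends are close. -/
theorem exists_close_return_le_half {z : X} {q : ℕ} (hq : 0 < q) (hz : IsPeriodicPt T q z) {D : ℝ}
    {i j : ℕ} (hij : dist (T^[i] z) (T^[j] z) < D) (hne : T^[i] z ≠ T^[j] z) :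
    ∃ a m : ℕ, 0 < m ∧ 2 * m ≤ q ∧ dist (T^[a] z) (T^[m] (T^[a] z)) < D := by
  rw [← hz.iterate_mod_apply i, ← hz.iterate_mod_apply j] at hij hne
  have hi := Nat.mod_lt i hq
  have hj := Nat.mod_lt j hq
  generalize i % q = i at *
  generalize j % q = j at *
  wlog h : i ≤ j generalizing i j
  · exact this j hj i hi (by rwa [dist_comm]) hne.symm (by omega)
  have hlt : i < j := lt_of_le_of_ne h fun h => hne (by rw [h])
  rcases Nat.lt_or_ge q (2 * (j - i)) with h2 | h2
  · refine ⟨j, q - (j - i), by omega, by omega, ?_⟩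
    rw [← iterate_add_apply, show q - (j - i) + j = i + q by omega, iterate_add_apply _ i, hz.eq,
      dist_comm]
    exact hij
  · refine ⟨i, j - i, by omega, by omega, ?_⟩
    rw [← iterate_add_apply, Nat.sub_add_cancel h]
    exact hij

/-- The triangle inequality combined with subadditivity of t ↦ t^α for α ≤ 1. -/
theorem infDist_rpow_le_add {Z : Set X} {α : ℝ} (hα : 0 < α) (hα1 : α ≤ 1) (x y : X) :
    Metric.infDist x Z ^ α ≤ Metric.infDist y Z ^ α + dist y x ^ α := by
  refine (Real.rpow_le_rpow Metric.infDist_nonneg ?_ hα.le).trans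
    (Real.rpow_add_le_add_rpow Metric.infDist_nonneg dist_nonneg hα.le hα1)
  rw [dist_comm]
  exact Metric.infDist_le_infDist_add_dist

/-- A forward invariant set is shadowed by periodic orbits whose total distance to the set is small
compared with the gaps between their points. -/
theorem AnosovShadowing.exists_separated_orbit [CompactSpace X] (hT : AnosovShadowing T)
    {Z : Set X} (hZ : Z.Nonempty) (hTZ : MapsTo T Z Z) {α : ℝ} (hα : 0 < α) (hα1 : α ≤ 1) {P : ℝ}
    (hP : 0 < P) {smax : ℝ} (hsmax : 0 < smax) :
    ∃ z ∈ periodicPts T, ∃ s D : ℝ, 0 < s ∧ s ≤ smax ∧ 0 < D ∧ D ^ α = P * s ∧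
      ∑ k ∈ Finset.range (minimalPeriod T z), Metric.infDist (T^[k] z) Z ^ α ≤ s ∧
      ∀ i j, dist (T^[i] z) (T^[j] z) < D → T^[i] z = T^[j] z := by
  obtain ⟨δ, C, L, hδ, hC, hL, hsum, hshad⟩ := hT.exists_sum_le hα
  set D₀ : ℝ := δ / (1 + L) with hD₀
  have hD₀pos : 0 < D₀ := by positivity
  -- One cut multiplies s by the factor on the left, and halving the period gains 2^k in s·q^k.
  obtain ⟨k, hk⟩ := pow_unbounded_of_one_lt (1 + C * (1 + L) ^ α * P) (one_lt_two (α := ℝ))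
  -- The second entry forces D ≤ D₀, hence (1 + L)D ≤ δ, so that both halves of shadowing apply.
  set σ : ℝ := min smax (D₀ ^ α / P) with hσ
  have hσ0 : 0 < σ := by positivity
  have main : ∀ q : ℕ, ∀ z ∈ periodicPts T, minimalPeriod T z = q → ∀ s : ℝ, 0 < s →
      ∑ k ∈ Finset.range (minimalPeriod T z), Metric.infDist (T^[k] z) Z ^ α ≤ s →
      s * (q : ℝ) ^ k ≤ σ → ∃ z ∈ periodicPts T, ∃ s D : ℝ, 0 < s ∧ s ≤ smax ∧ 0 < D ∧
      D ^ α = P * s ∧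
      ∑ k ∈ Finset.range (minimalPeriod T z), Metric.infDist (T^[k] z) Z ^ α ≤ s ∧
      ∀ i j, dist (T^[i] z) (T^[j] z) < D → T^[i] z = T^[j] z := by
    intro q
    induction q using Nat.strong_induction_on with
    | _ q ih =>
    intro z hz hq s hs hS hsq
    have hq0 : 0 < q := hq ▸ minimalPeriod_pos_of_mem_periodicPts hz
    have hsσ : s ≤ σ := by
      refine le_trans (le_mul_of_one_le_right hs.le (one_le_pow₀ ?_)) hsq
      exact_mod_cast hq0
    set D : ℝ := (P * s) ^ (1 / α) with hD
    have hDpos : 0 < D := by positivity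
    have hDα : D ^ α = P * s := by
      rw [hD, ← Real.rpow_mul (by positivity), one_div_mul_cancel hα.ne', Real.rpow_one]
    have hDD₀ : D ≤ D₀ := by
      rw [← Real.rpow_le_rpow_iff hDpos.le hD₀pos.le hα, hDα]
      have h1 := hsσ.trans (min_le_right _ _)
      rw [le_div_iff₀ hP] at h1
      linarith
    have hDδ : (1 + L) * D ≤ δ := by
      rw [hD₀, le_div_iff₀ (by positivity)] at hDD₀
      linarith
    by_cases hsep : ∀ i j, dist (T^[i] z) (T^[j] z) < D → T^[i] z = T^[j] z
    · exact ⟨z, hz, s, D, hs, hsσ.trans (min_le_left _ _), hDpos, hDα, hS, hsep⟩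
    push Not at hsep
    obtain ⟨i, j, hij, hne⟩ := hsep
    have hzq : IsPeriodicPt T q z := hq ▸ isPeriodicPt_minimalPeriod T z
    obtain ⟨a, m, hm, hmq, hclose⟩ := exists_close_return_le_half hq0 hzq hij hne
    set y := T^[a] z with hy
    have hpo : IsPeriodicPseudoOrbit T D m (fun i => T^[i] y) := by
      intro i hi
      beta_reduce
      rcases lt_or_ge (i + 1) m with h | h
      · rw [Nat.mod_eq_of_lt h, ← iterate_succ_apply' T, dist_self]
        exact hDpos.le
      · have h' : i + 1 = m := by omega
        rw [h', Nat.mod_self, ← iterate_succ_apply' T, Nat.succ_eq_add_one, h', iterate_zero_apply]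
        exact hclose.le
    obtain ⟨w, hw, hdvd, hsh⟩ := hshad D m _ hDpos.le (by nlinarith) hm hpo
    have hwm : IsPeriodicPt T m w := (isPeriodicPt_minimalPeriod T w).trans_dvd hdvd
    have hwpos := minimalPeriod_pos_of_mem_periodicPts hw
    have hwle : minimalPeriod T w ≤ m := Nat.le_of_dvd hm hdvd
    have hyw : dist y w ≤ L * D := hsh 0 hm
    have hend : dist (T^[m] y) (T^[m] w) ≤ (1 + L) * D := by
      rw [hwm.eq]
      have := dist_triangle_left (T^[m] y) w y
      linarith
    have hsumyw := hsum ((1 + L) * D) m y w (fun i hi => by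
      rcases hi.lt_or_eq with h | rfl
      · have := hsh i h
        linarith
      · linarith) (by linarith) hend
    rw [Real.mul_rpow (by positivity) hDpos.le, hDα] at hsumyw
    have hSy : ∑ k ∈ Finset.range m, Metric.infDist (T^[k] y) Z ^ α ≤ s := by
      refine le_trans ?_ hS
      rw [hq, ← sum_orbit_shift hzq (fun x => Metric.infDist x Z ^ α) a]
      refine Finset.sum_le_sum_of_subset_of_nonneg (Finset.range_mono (by omega)) ?_
      intro _ _ _
      exact Real.rpow_nonneg Metric.infDist_nonneg _
    -- The new orbit follows the cut arc with endpoint errors at most (1 + L)D, so the summed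
    -- estimate adds C(1 + L)^α D^α, where D^α = P·s.
    set s' := s * (1 + C * (1 + L) ^ α * P) with hs'
    have hs'pos : 0 < s' := by positivity
    refine ih _ (by omega) w hw rfl s' hs'pos ?_ ?_
    · calc ∑ k ∈ Finset.range (minimalPeriod T w), Metric.infDist (T^[k] w) Z ^ α
          ≤ ∑ k ∈ Finset.range m, Metric.infDist (T^[k] w) Z ^ α := by
            refine Finset.sum_le_sum_of_subset_of_nonneg (Finset.range_mono hwle) ?_
            intro _ _ _
            exact Real.rpow_nonneg Metric.infDist_nonneg _
        _ ≤ ∑ k ∈ Finset.range m,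
            (Metric.infDist (T^[k] y) Z ^ α + dist (T^[k] y) (T^[k] w) ^ α) :=
            Finset.sum_le_sum fun k _ => infDist_rpow_le_add hα hα1 _ _
        _ ≤ s + ∑ k ∈ Finset.range (m + 1), dist (T^[k] y) (T^[k] w) ^ α := by
            rw [Finset.sum_add_distrib]
            refine add_le_add hSy
              (Finset.sum_le_sum_of_subset_of_nonneg (Finset.range_mono (by omega)) ?_)
            intro _ _ _
            exact Real.rpow_nonneg dist_nonneg _
        _ ≤ s' := by rw [hs']; linarith
    · calc s' * (minimalPeriod T w : ℝ) ^ k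
          ≤ (s * 2 ^ k) * (minimalPeriod T w : ℝ) ^ k := by rw [hs']; gcongr
        _ = s * (2 * (minimalPeriod T w : ℝ)) ^ k := by rw [mul_pow]; ring
        _ ≤ s * (q : ℝ) ^ k := by
            gcongr
            exact_mod_cast (by omega : 2 * minimalPeriod T w ≤ q)
        _ ≤ σ := hsq
  obtain ⟨z, hz, η, hη, hnear, hsmall⟩ :=
    hT.exists_periodic_near hZ hTZ hα (k + 1) (half_pos hσ0)
  set q := minimalPeriod T z with hq
  have hq0 : (1 : ℝ) ≤ q := by exact_mod_cast minimalPeriod_pos_of_mem_periodicPts hz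
  have hq1 : (0 : ℝ) < (q : ℝ) ^ k := by positivity
  -- The second summand keeps s positive even when η = 0. The extra power of q obtained from `k + 1`
  -- pays for the q terms of the sum.
  refine main q z hz rfl (q * η ^ α + σ / 2 / (q : ℝ) ^ k) (by positivity) ?_ ?_
  · refine le_add_of_le_of_nonneg ?_ (by positivity)
    calc _ ≤ ∑ k ∈ Finset.range q, η ^ α := Finset.sum_le_sum fun k _ =>
          Real.rpow_le_rpow Metric.infDist_nonneg (hnear k) hα.le
      _ = _ := by simp
  · rw [add_mul, div_mul_cancel₀ _ hq1.ne']
    have : (q : ℝ) * η ^ α * (q : ℝ) ^ k = (q : ℝ) ^ (k + 1) * η ^ α := by ring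
    linarith

end Separated

/-! ### Lower bounds for Birkhoff sums near a separated orbit. -/

section Birkhoff

open Filter Topology Set Function

/-- The forward orbit of `z`. -/
abbrev orbit {X : Type*} (T : X → X) (z : X) : Set X := Set.range fun k : ℕ => T^[k] z

theorem iterate_mem_orbit {X : Type*} {T : X → X} {z y : X} (hy : y ∈ orbit T z) (k : ℕ) :
    T^[k] y ∈ orbit T z := by
  obtain ⟨j, rfl⟩ := hy
  exact ⟨k + j, by simp only [iterate_add_apply]⟩

theorem orbit_finite {X : Type*} {T : X → X} {z : X} (hz : z ∈ periodicPts T) :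
    (orbit T z).Finite := by
  refine ((Finset.range (minimalPeriod T z)).finite_toSet.image fun k => T^[k] z).subset ?_
  rintro _ ⟨k, rfl⟩
  refine ⟨k % minimalPeriod T z, ?_, iterate_mod_minimalPeriod_eq⟩
  simpa using Nat.mod_lt k (minimalPeriod_pos_of_mem_periodicPts hz)

theorem isPeriodicPt_of_mem_orbit {X : Type*} {T : X → X} {z y : X} (hy : y ∈ orbit T z) :
    IsPeriodicPt T (minimalPeriod T z) y := by
  obtain ⟨j, rfl⟩ := hy
  exact (isPeriodicPt_minimalPeriod T z).apply_iterate j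

theorem birkhoffSum_orbit_period {X : Type*} {T : X → X} {z y : X} (F : X → ℝ)
    (hy : y ∈ orbit T z) :
    birkhoffSum T F (minimalPeriod T z) y =
      ∑ k ∈ Finset.range (minimalPeriod T z), F (T^[k] z) := by
  obtain ⟨j, rfl⟩ := hy
  exact sum_orbit_shift (isPeriodicPt_minimalPeriod T z) F j

/-- Full periods contribute zero, leaving fewer than one period of terms, each at least −R. -/
theorem neg_le_birkhoffSum_orbit {X : Type*} {T : X → X} {z : X} (hz : z ∈ periodicPts T)
    {F : X → ℝ} {R : ℝ} (hR : 0 ≤ R) (hF : ∀ y ∈ orbit T z, -R ≤ F y)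
    (hsum : ∑ k ∈ Finset.range (minimalPeriod T z), F (T^[k] z) = 0) (n : ℕ) :
    ∀ y ∈ orbit T z, -(minimalPeriod T z * R) ≤ birkhoffSum T F n y := by
  intro y hy
  set q := minimalPeriod T z with hq
  have hq0 : 0 < q := minimalPeriod_pos_of_mem_periodicPts hz
  induction n using Nat.strong_induction_on with
  | _ n ih =>
  rcases lt_or_ge n q with h | h
  · have h1 : (n : ℝ) * R ≤ q * R := by gcongr
    have h2 : ∑ k ∈ Finset.range n, -R ≤ birkhoffSum T F n y :=
      Finset.sum_le_sum fun k _ => hF _ (iterate_mem_orbit hy k)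
    simp only [Finset.sum_const, Finset.card_range, nsmul_eq_mul] at h2
    linarith
  · obtain ⟨m, rfl⟩ := Nat.exists_eq_add_of_le h
    rw [birkhoffSum_add, birkhoffSum_orbit_period F hy, hsum,
      (isPeriodicPt_of_mem_orbit hy).eq, zero_add]
    exact ih m (by omega)

variable {X : Type*} [MetricSpace X]

/-- Lower bound for the Birkhoff sums of a function which is positive away from a periodic orbit,
and whose sum over this orbit vanishes. -/
theorem exists_le_birkhoffSum {T : X → X} {κ : ℝ≥0} (hT : LipschitzWith κ T) {z : X}
    (hz : z ∈ periodicPts T) {α δ C ε R H D ρ : ℝ} (hα : 0 < α) (hε : 0 < ε) (hR : 0 ≤ R)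
    (hH : 0 ≤ H) (hC : 0 ≤ C)
    (hasp : ∀ (η : ℝ) (m : ℕ) (x y : X), (∀ i ≤ m, dist (T^[i] x) (T^[i] y) ≤ δ) →
        dist x y ≤ η → dist (T^[m] x) (T^[m] y) ≤ η →
        ∑ k ∈ Finset.range (m + 1), dist (T^[k] x) (T^[k] y) ^ α ≤ C * η ^ α)
    (hsep : ∀ i j, dist (T^[i] z) (T^[j] z) < D → T^[i] z = T^[j] z)
    {F : X → ℝ} (hF : ∀ x, ε * Metric.infDist x (orbit T z) ^ α - R ≤ F x)
    (hFH : ∀ x y, F y - H * dist x y ^ α ≤ F x)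
    (hsum : ∑ k ∈ Finset.range (minimalPeriod T z), F (T^[k] z) = 0)
    (hρ : 0 < ρ) (hρD : (2 + κ) * ρ < D) (hρδ : ρ ≤ δ)
    (hbal : minimalPeriod T z * R + H * (C * (R / ε)) + R ≤ ε * ρ ^ α) :
    ∃ A, ∀ n x, -A ≤ birkhoffSum T F n x := by
  -- The first term pays for an incomplete turn around the orbit, the second for the error of
  -- tracking it.
  set A := minimalPeriod T z * R + H * (C * (R / ε)) with hA
  have hA0 : 0 ≤ A := by positivity
  set O := orbit T z with hO
  have hOne : O.Nonempty := range_nonempty _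
  have hOc : IsCompact O := (orbit_finite hz).isCompact
  -- Beyond distance η from the orbit, F is nonnegative.
  set η : ℝ := (R / ε) ^ (1 / α) with hη
  have hηα : η ^ α = R / ε := by
    rw [hη, ← Real.rpow_mul (by positivity), one_div_mul_cancel hα.ne', Real.rpow_one]
  have hη0 : 0 ≤ η := by positivity
  have hsep' : ∀ y ∈ O, ∀ y' ∈ O, dist y y' < D → y = y' := by
    rintro _ ⟨i, rfl⟩ _ ⟨j, rfl⟩ h
    exact hsep i j h
  have hFO : ∀ y ∈ O, -R ≤ F y := fun y hy => by
    have := hF y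
    rwa [Metric.infDist_zero_of_mem hy, Real.zero_rpow hα.ne', mul_zero, zero_sub] at this
  have hfar : ∀ x, η < Metric.infDist x O → 0 ≤ F x := fun x hx => by
    have h1 : R / ε ≤ Metric.infDist x O ^ α := by
      rw [← hηα]; exact Real.rpow_le_rpow hη0 hx.le hα.le
    rw [div_le_iff₀ hε] at h1
    have := hF x
    linarith
  -- Within ρ of the orbit, the gap D leaves only one candidate for the nearest point at the next
  -- step, so a single orbit point y is tracked throughout. The summed contraction estimate then
  -- depends only on the endpoint distances, which are at most η.
  have hseg : ∀ m x, (∀ k ≤ m, Metric.infDist (T^[k] x) O ≤ ρ) → Metric.infDist x O ≤ η →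
      Metric.infDist (T^[m] x) O ≤ η → -A ≤ birkhoffSum T F (m + 1) x := by
    intro m x hnear h0 hm
    obtain ⟨y, hy, hxy⟩ := hOc.exists_infDist_eq_dist hOne x
    have htrack : ∀ k ≤ m, dist (T^[k] x) (T^[k] y) ≤ ρ ∧
        dist (T^[k] x) (T^[k] y) = Metric.infDist (T^[k] x) O := by
      intro k
      induction k with
      | zero =>
        intro _
        exact ⟨hxy ▸ hnear 0 (Nat.zero_le _), hxy.symm⟩
      | succ k ih =>
        intro hk
        have h1 := (ih (by omega)).1
        have h2 : dist (T^[k + 1] x) (T^[k + 1] y) ≤ κ * ρ := by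
          rw [iterate_succ_apply', iterate_succ_apply']
          exact (hT.dist_le_mul _ _).trans (by gcongr)
        obtain ⟨y', hy', hxy'⟩ := hOc.exists_infDist_eq_dist hOne (T^[k + 1] x)
        have h3 := hnear (k + 1) hk
        have h4 : T^[k + 1] y = y' := by
          refine hsep' _ (iterate_mem_orbit hy _) _ hy' (lt_of_le_of_lt ?_ hρD)
          have := dist_triangle_left (T^[k + 1] y) y' (T^[k + 1] x)
          nlinarith
        rw [h4]
        exact ⟨hxy' ▸ h3, hxy'.symm⟩
    have h1 := hasp η m x y (fun i hi => (htrack i hi).1.trans hρδ) (hxy ▸ h0)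
      ((htrack m le_rfl).2 ▸ hm)
    rw [hηα] at h1
    have h2 := neg_le_birkhoffSum_orbit hz hR hFO hsum (m + 1) y hy
    have h3 : birkhoffSum T F (m + 1) y -
        H * ∑ k ∈ Finset.range (m + 1), dist (T^[k] x) (T^[k] y) ^ α ≤
          birkhoffSum T F (m + 1) x := by
      unfold birkhoffSum
      rw [Finset.mul_sum, ← Finset.sum_sub_distrib]
      exact Finset.sum_le_sum fun k _ => hFH _ _
    have h4 : H * ∑ k ∈ Finset.range (m + 1), dist (T^[k] x) (T^[k] y) ^ α ≤
        H * (C * (R / ε)) := by gcongr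
    linarith
  -- Final terms at distance above η are nonnegative and can be dropped; `hnear` does the same at
  -- the start.
  have hright : ∀ n x, (∀ k < n, Metric.infDist (T^[k] x) O ≤ ρ) → Metric.infDist x O ≤ η →
      -A ≤ birkhoffSum T F n x := by
    intro n x hnear h0
    induction n with
    | zero => rw [birkhoffSum_zero]; linarith
    | succ n ih =>
      rcases le_or_gt (Metric.infDist (T^[n] x) O) η with h | h
      · exact hseg n x (fun k hk => hnear k (by omega)) h0 h
      · rw [birkhoffSum_succ]
        have := ih fun k hk => hnear k (by omega)
        have := hfar _ h
        linarith
  have hnear : ∀ n x, (∀ k < n, Metric.infDist (T^[k] x) O ≤ ρ) → -A ≤ birkhoffSum T F n x := by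
    intro n
    induction n with
    | zero => intro x _; rw [birkhoffSum_zero]; linarith
    | succ n ih =>
      intro x hx
      rcases le_or_gt (Metric.infDist x O) η with h | h
      · exact hright _ x hx h
      · rw [birkhoffSum_succ']
        have := ih (T x) fun k hk => hx (k + 1) (by omega)
        have := hfar _ h
        linarith
  refine ⟨A, fun n => ?_⟩
  induction n using Nat.strong_induction_on with
  | _ n ih =>
  intro x
  by_cases hall : ∀ k < n, Metric.infDist (T^[k] x) O ≤ ρ
  · exact hnear n x hall
  push Not at hall
  classical
  obtain ⟨hk1, hk2⟩ := Nat.find_spec hall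
  have hkmin := fun j (hj : j < Nat.find hall) => Nat.find_min hall hj
  generalize Nat.find hall = k at *
  obtain ⟨m, rfl⟩ := Nat.exists_eq_add_of_lt hk1
  have h1 : -A ≤ birkhoffSum T F k x := hnear k x fun j hj => by
    by_contra! hc
    exact hkmin j hj ⟨by omega, hc⟩
  have h2 : -A ≤ birkhoffSum T F m (T^[k + 1] x) := ih m (by omega) _
  -- At the first exit from the ρ-neighbourhood, F is at least ερ^α − R ≥ A, which cancels the loss
  -- of the preceding near segment.
  have h3 : ε * ρ ^ α ≤ ε * Metric.infDist (T^[k] x) O ^ α := by gcongr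
  have h4 := hF (T^[k] x)
  rw [show k + m + 1 = (k + 1) + m by ring, birkhoffSum_add, birkhoffSum_succ]
  linarith

end Birkhoff

/-! ### Periodic orbit measures and integrals of Birkhoff sums. -/

section OrbitMeasure

open Filter Topology Set Function
open scoped ENNReal

theorem continuous_birkhoffSum {X : Type*} [TopologicalSpace X] {T : X → X} (hT : Continuous T) {F : X → ℝ} (hF : Continuous F) (n : ℕ) :
    Continuous (birkhoffSum T F n) := by
  unfold birkhoffSum
  exact continuous_finsetSum _ fun k _ => hF.comp (hT.iterate k)

/-- The invariant probability measure carried by the periodic orbit of `z`. -/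
noncomputable def orbitMeasure {X : Type*} [MeasurableSpace X] (T : X → X) (z : X) : Measure X :=
  (minimalPeriod T z : ℝ≥0∞)⁻¹ • ∑ k ∈ Finset.range (minimalPeriod T z), Measure.dirac (T^[k] z)

theorem orbitMeasure_apply {X : Type*} [MeasurableSpace X] {T : X → X} (z : X) {S : Set X} (hS : MeasurableSet S) :
    orbitMeasure T z S = (minimalPeriod T z : ℝ≥0∞)⁻¹ *
      ∑ k ∈ Finset.range (minimalPeriod T z), S.indicator 1 (T^[k] z) := by
  simp [orbitMeasure, Measure.dirac_apply' _ hS]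

variable {X : Type*} [MetricSpace X] [MeasurableSpace X] [BorelSpace X] {T : X → X}

theorem integral_comp_iterate {μ : Measure X} (hμ : MeasurePreserving T μ μ) {F : X → ℝ}
    (hF : Continuous F) (k : ℕ) : ∫ x, F (T^[k] x) ∂μ = ∫ x, F x ∂μ := by
  have h := hμ.iterate k
  conv_rhs => rw [← h.map_eq]
  rw [integral_map h.measurable.aemeasurable hF.aestronglyMeasurable]

theorem orbitMeasure_mem_invariantMeasures (hT : Continuous T) {z : X} (hz : z ∈ periodicPts T) :
    orbitMeasure T z ∈ invariantMeasures T := by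
  have hq : minimalPeriod T z ≠ 0 := (minimalPeriod_pos_of_mem_periodicPts hz).ne'
  refine ⟨⟨?_⟩, hT.measurable, ?_⟩
  · rw [orbitMeasure_apply _ MeasurableSet.univ]
    simp [ENNReal.inv_mul_cancel, hq]
  · ext S hS
    rw [Measure.map_apply hT.measurable hS, orbitMeasure_apply _ hS,
      orbitMeasure_apply _ (hT.measurable hS),
      ← sum_orbit_shift (isPeriodicPt_minimalPeriod T z) (S.indicator (1 : X → ℝ≥0∞)) 1]
    congr 1
    refine Finset.sum_congr rfl fun k _ => ?_
    rw [← iterate_add_apply, iterate_succ_apply']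
    rfl

theorem integral_orbitMeasure {z : X} (f : X → ℝ) :
    ∫ x, f x ∂orbitMeasure T z =
      (∑ k ∈ Finset.range (minimalPeriod T z), f (T^[k] z)) / minimalPeriod T z := by
  rw [orbitMeasure, integral_smul_measure, integral_finsetSum_measure]
  · simp [div_eq_inv_mul]
  · intro k _
    exact integrable_dirac (by simp)

theorem orbitMeasure_compl_orbit {z : X} (hz : z ∈ periodicPts T) :
    orbitMeasure T z (orbit T z)ᶜ = 0 := by
  rw [orbitMeasure_apply _ (orbit_finite hz).measurableSet.compl]
  simp only [mul_eq_zero]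
  right
  refine Finset.sum_eq_zero fun k _ => ?_
  rw [indicator_of_notMem]
  simp

variable [CompactSpace X]

theorem integrable_of_continuous {μ : Measure X} [IsFiniteMeasure μ] {F : X → ℝ}
    (hF : Continuous F) : Integrable F μ :=
  hF.integrable_of_hasCompactSupport (HasCompactSupport.of_compactSpace F)

theorem integral_birkhoffSum {μ : Measure X} [IsFiniteMeasure μ] (hμ : MeasurePreserving T μ μ)
    (hT : Continuous T) {F : X → ℝ} (hF : Continuous F) (n : ℕ) :
    ∫ x, birkhoffSum T F n x ∂μ = n * ∫ x, F x ∂μ := by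
  simp only [birkhoffSum]
  rw [integral_finsetSum (f := fun k x => F (T^[k] x)) _
    fun k _ => integrable_of_continuous (hF.comp (hT.iterate k))]
  simp [integral_comp_iterate hμ hF]

/-- Invariance gives n∫F ≥ −A for every n. -/
theorem integral_nonneg_of_birkhoffSum {μ : Measure X} (hμ : μ ∈ invariantMeasures T)
    (hT : Continuous T) {F : X → ℝ} (hF : Continuous F) {A : ℝ}
    (hA : ∀ n x, -A ≤ birkhoffSum T F n x) : 0 ≤ ∫ x, F x ∂μ := by
  obtain ⟨hprob, hpres⟩ := hμ
  by_contra! hneg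
  obtain ⟨n, hn⟩ := exists_nat_gt (A / -∫ x, F x ∂μ)
  rw [div_lt_iff₀ (by linarith)] at hn
  have h1 : ∫ _, -A ∂μ ≤ ∫ x, birkhoffSum T F n x ∂μ :=
    integral_mono (integrable_const _) (integrable_of_continuous (continuous_birkhoffSum hT hF n))
      fun x => hA n x
  rw [integral_birkhoffSum hpres hT hF] at h1
  simp at h1
  linarith

/-- The sum of a test function over one period is constant on the orbit, and invariance identifies
its μ-integral with q∫f dμ; this determines ∫f dμ. -/
theorem eq_orbitMeasure (hT : Continuous T) {z : X} (hz : z ∈ periodicPts T) {μ : Measure X}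
    (hμ : μ ∈ invariantMeasures T) (h0 : μ (orbit T z)ᶜ = 0) : μ = orbitMeasure T z := by
  obtain ⟨hprob, hpres⟩ := hμ
  have := (orbitMeasure_mem_invariantMeasures hT hz).1
  have hq : (minimalPeriod T z : ℝ) ≠ 0 := by
    exact_mod_cast (minimalPeriod_pos_of_mem_periodicPts hz).ne'
  refine ext_of_forall_integral_eq_of_IsFiniteMeasure fun f => ?_
  have hae : ∀ᵐ x ∂μ, birkhoffSum T f (minimalPeriod T z) x =
      ∑ k ∈ Finset.range (minimalPeriod T z), f (T^[k] z) := by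
    have : ∀ᵐ x ∂μ, x ∈ orbit T z := h0
    filter_upwards [this] with x hx using birkhoffSum_orbit_period f hx
  have h1 := integral_congr_ae hae
  rw [integral_birkhoffSum hpres hT f.continuous] at h1
  simp only [integral_const, probReal_univ, one_smul] at h1
  rw [integral_orbitMeasure, ← h1]
  field_simp

end OrbitMeasure

/-! ### Elementary facts on Hölder functions. -/

section HolderFacts

open Filter Topology Set Function

variable {X : Type*} [MetricSpace X] {α : ℝ≥0}

theorem _root_.MemHolder.exists_abs_sub_le {u : X → ℝ} (hu : MemHolder α u) :
    ∃ H : ℝ, 0 ≤ H ∧ ∀ x y, |u x - u y| ≤ H * dist x y ^ (α : ℝ) := by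
  obtain ⟨C, hC⟩ := hu
  exact ⟨C, C.2, fun x y => by rw [← Real.dist_eq]; exact hC.dist_le x y⟩

theorem _root_.HolderWith.of_abs_sub_le {u : X → ℝ} {H : ℝ} (hH : 0 ≤ H)
    (h : ∀ x y, |u x - u y| ≤ H * dist x y ^ (α : ℝ)) : HolderWith H.toNNReal α u := by
  intro x y
  change edist (u x) (u y) ≤ ENNReal.ofReal H * edist x y ^ (α : ℝ)
  rw [edist_dist, edist_dist, ENNReal.ofReal_rpow_of_nonneg dist_nonneg (NNReal.coe_nonneg α), Real.dist_eq,
    ← ENNReal.ofReal_mul hH]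
  exact ENNReal.ofReal_le_ofReal (h x y)

theorem _root_.MemHolder.continuous {u : X → ℝ} (hu : MemHolder α u) (hα : 0 < α) :
    Continuous u := by
  obtain ⟨C, hC⟩ := hu
  exact hC.continuous hα

theorem _root_.MemHolder.comp_lipschitz {u : X → ℝ} (hu : MemHolder α u) {S : X → X} {κ : ℝ≥0}
    (hS : LipschitzWith κ S) : MemHolder α (u ∘ S) := by
  obtain ⟨C, hC⟩ := hu
  have h := hC.comp (holderWith_one.2 hS)
  rw [mul_one] at h
  exact h.memHolder

theorem _root_.MemHolder.birkhoffAverage {u : X → ℝ} (hu : MemHolder α u) {T : X → X} {κ : ℝ≥0}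
    (hT : LipschitzWith κ T) (K : ℕ) : MemHolder α (birkhoffAverage ℝ T u K) := by
  have h : MemHolder α (birkhoffSum T u K) := by
    induction K with
    | zero => rw [birkhoffSum_zero']; exact memHolder_zero
    | succ n ih =>
      have : birkhoffSum T u (n + 1) = birkhoffSum T u n + u ∘ T^[n] := by
        funext x; exact birkhoffSum_succ T u n x
      rw [this]
      exact ih.add (hu.comp_lipschitz (hT.iterate n))
  have h2 : _root_.birkhoffAverage ℝ T u K = (K : ℝ)⁻¹ • birkhoffSum T u K := rfl
  rw [h2]
  exact h.smul

theorem abs_infDist_rpow_sub_le {Z : Set X} {α : ℝ} (hα : 0 < α) (hα1 : α ≤ 1) (x y : X) :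
    |Metric.infDist x Z ^ α - Metric.infDist y Z ^ α| ≤ dist x y ^ α := by
  have h1 := infDist_rpow_le_add (Z := Z) hα hα1 x y
  have h2 := infDist_rpow_le_add (Z := Z) hα hα1 y x
  rw [dist_comm] at h1
  rw [abs_sub_le_iff]
  constructor <;> linarith

theorem continuous_infDist_rpow (Z : Set X) {α : ℝ} (hα : 0 < α) :
    Continuous fun x => Metric.infDist x Z ^ α :=
  (Metric.continuous_infDist_pt Z).rpow_const fun _ => Or.inr hα.le

end HolderFacts

/-! ### Normalization and a criterion for unique minimization. -/

section Core

open Filter Topology Set Function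

theorem exists_bounds_of_pos {X : Type*} [TopologicalSpace X] [CompactSpace X] [Nonempty X] {ψ : X → ℝ} (hψ : Continuous ψ) (hψ0 : ∀ x, 0 < ψ x) :
    ∃ m M : ℝ, 0 < m ∧ (∀ x, m ≤ ψ x) ∧ ∀ x, ψ x ≤ M := by
  obtain ⟨a, -, ha⟩ := isCompact_univ.exists_isMinOn univ_nonempty hψ.continuousOn
  obtain ⟨b, -, hb⟩ := isCompact_univ.exists_isMaxOn univ_nonempty hψ.continuousOn
  exact ⟨ψ a, ψ b, hψ0 a, fun x => ha (mem_univ x), fun x => hb (mem_univ x)⟩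

variable {X : Type*} [MetricSpace X] [CompactSpace X] [MeasurableSpace X] [BorelSpace X]
  {T : X → X}

theorem integral_birkhoffAverage {μ : Measure X} [IsFiniteMeasure μ]
    (hμ : MeasurePreserving T μ μ) (hT : Continuous T) {F : X → ℝ} (hF : Continuous F) {n : ℕ}
    (hn : 0 < n) : ∫ x, birkhoffAverage ℝ T F n x ∂μ = ∫ x, F x ∂μ := by
  simp only [birkhoffAverage, smul_eq_mul]
  rw [integral_const_mul, integral_birkhoffSum hμ hT hF]
  field_simp

/-- The distance term makes the inequality strict: a minimizing measure has zero mean distance to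
the orbit, hence lives on it and is its orbit measure. -/
theorem uniquelyPeriodicallyMinimized_of_integral_le (hT : Continuous T) {z : X}
    (hz : z ∈ periodicPts T) {u ψ : X → ℝ} (hψ : Continuous ψ) (hψ0 : ∀ x, 0 < ψ x) {α ε b : ℝ}
    (hα : 0 < α) (hε : 0 < ε)
    (hO : ∫ x, u x ∂orbitMeasure T z = b * ∫ x, ψ x ∂orbitMeasure T z)
    (hle : ∀ μ ∈ invariantMeasures T, b * ∫ x, ψ x ∂μ +
      ε * ∫ x, Metric.infDist x (orbit T z) ^ α ∂μ ≤ ∫ x, u x ∂μ) :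
    UniquelyPeriodicallyMinimized T u ψ := by
  have hpos : ∀ μ ∈ invariantMeasures T, 0 < ∫ x, ψ x ∂μ := by
    intro μ hμ
    have := hμ.1
    rw [integral_pos_iff_support_of_nonneg (fun x => (hψ0 x).le) (integrable_of_continuous hψ)]
    have : support ψ = univ := eq_univ_of_forall fun x => (hψ0 x).ne'
    rw [this, measure_univ]
    exact one_pos
  have hOmem := orbitMeasure_mem_invariantMeasures hT hz
  have hOrat : (∫ x, u x ∂orbitMeasure T z) / ∫ x, ψ x ∂orbitMeasure T z = b := by
    rw [hO, mul_div_cancel_right₀ _ (hpos _ hOmem).ne']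
  have hdist : ∀ μ : Measure X, 0 ≤ ∫ x, Metric.infDist x (orbit T z) ^ α ∂μ := fun μ =>
    integral_nonneg fun x => Real.rpow_nonneg Metric.infDist_nonneg _
  have hmin : ratioMinErgodicAverage T u ψ = b := by
    refine IsLeast.csInf_eq ⟨⟨_, hOmem, hOrat⟩, ?_⟩
    rintro _ ⟨μ, hμ, rfl⟩
    simp only
    rw [le_div_iff₀ (hpos μ hμ)]
    have := hle μ hμ
    have := mul_nonneg hε.le (hdist μ)
    linarith
  refine ⟨orbitMeasure T z, ?_, z, hz, orbitMeasure_compl_orbit hz⟩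
  ext μ
  simp only [mem_singleton_iff]
  refine ⟨fun hμ => ?_, fun hμ => ?_⟩
  · obtain ⟨hinv, hrat⟩ := hμ
    have hprob := hinv.1
    rw [hmin, div_eq_iff (hpos μ hinv).ne'] at hrat
    have h1 := hle μ hinv
    have h2 : ∫ x, Metric.infDist x (orbit T z) ^ α ∂μ = 0 := by
      refine le_antisymm ?_ (hdist μ)
      by_contra! h
      have := mul_pos hε h
      linarith
    rw [integral_eq_zero_iff_of_nonneg (fun x => Real.rpow_nonneg Metric.infDist_nonneg _)
      (integrable_of_continuous (continuous_infDist_rpow _ hα))] at h2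
    refine eq_orbitMeasure hT hz hinv ?_
    change ∀ᵐ x ∂μ, x ∈ orbit T z
    filter_upwards [h2] with x hx
    have h3 : Metric.infDist x (orbit T z) = 0 :=
      (Real.rpow_eq_zero Metric.infDist_nonneg hα.ne').1 hx
    exact ((orbit_finite hz).isClosed.mem_iff_infDist_zero (range_nonempty _)).2 h3
  · rw [hμ]
    exact ⟨hOmem, hOrat.trans hmin.symm⟩

/-- The closing lemma applied to the whole space produces a periodic point. -/
theorem AnosovShadowing.nonempty_invariantMeasures [Nonempty X] (hasp : AnosovShadowing T)
    (hT : Continuous T) : (invariantMeasures T).Nonempty := by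
  obtain ⟨z, hz, -⟩ := hasp.exists_periodic_near (univ_nonempty (α := X)) (mapsTo_univ T univ)
    one_pos 0 one_pos
  exact ⟨_, orbitMeasure_mem_invariantMeasures hT hz⟩

theorem le_integral_of_le {μ : Measure X} [IsProbabilityMeasure μ] {F : X → ℝ} (hF : Continuous F)
    {c : ℝ} (h : ∀ x, c ≤ F x) : c ≤ ∫ x, F x ∂μ := by
  have := integral_mono (μ := μ) (integrable_const c) (integrable_of_continuous hF) h
  simpa using this

theorem integral_le_of_le {μ : Measure X} [IsProbabilityMeasure μ] {F : X → ℝ} (hF : Continuous F)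
    {c : ℝ} (h : ∀ x, F x ≤ c) : ∫ x, F x ∂μ ≤ c := by
  have := integral_mono (μ := μ) (integrable_of_continuous hF) (integrable_const c) h
  simpa using this

/-- Subtracting `β(u; ψ) ψ` from `u` normalizes the ratio minimization problem. -/
theorem integral_sub_ratioMin [Nonempty X] (hne : (invariantMeasures T).Nonempty) {u ψ : X → ℝ}
    (hu : Continuous u) (hψ : Continuous ψ) (hψ0 : ∀ x, 0 < ψ x) :
    (∀ μ ∈ invariantMeasures T, 0 ≤ ∫ x, (u x - ratioMinErgodicAverage T u ψ * ψ x) ∂μ) ∧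
    ∀ e : ℝ, 0 < e → ∃ μ ∈ invariantMeasures T,
      ∫ x, (u x - ratioMinErgodicAverage T u ψ * ψ x) ∂μ < e := by
  obtain ⟨m, M, hm, hmψ, hψM⟩ := exists_bounds_of_pos hψ hψ0
  set β := ratioMinErgodicAverage T u ψ with hβ
  have hint : ∀ μ ∈ invariantMeasures T,
      ∫ x, (u x - β * ψ x) ∂μ = ∫ x, u x ∂μ - β * ∫ x, ψ x ∂μ := by
    intro μ hμ
    have := hμ.1
    rw [integral_sub (integrable_of_continuous hu)
      ((integrable_of_continuous hψ).const_mul β), integral_const_mul]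
  have hψi : ∀ μ ∈ invariantMeasures T, m ≤ ∫ x, ψ x ∂μ ∧ ∫ x, ψ x ∂μ ≤ M := by
    intro μ hμ
    have := hμ.1
    exact ⟨le_integral_of_le hψ hmψ, integral_le_of_le hψ hψM⟩
  have hbdd : BddBelow ((fun ν : Measure X => (∫ x, u x ∂ν) / ∫ x, ψ x ∂ν) ''
      invariantMeasures T) := by
    obtain ⟨a, -, ha⟩ := isCompact_univ.exists_isMinOn univ_nonempty hu.continuousOn
    refine ⟨-(|u a| / m), ?_⟩
    rintro _ ⟨μ, hμ, rfl⟩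
    have := hμ.1
    obtain ⟨h1, -⟩ := hψi μ hμ
    have h2 : u a ≤ ∫ x, u x ∂μ := le_integral_of_le hu fun x => ha (mem_univ x)
    simp only
    rw [le_div_iff₀ (by linarith), neg_mul, div_mul_eq_mul_div]
    have h3 : |u a| ≤ |u a| * (∫ x, ψ x ∂μ) / m := by
      rw [le_div_iff₀ hm]; gcongr
    have := neg_abs_le (u a)
    linarith
  refine ⟨fun μ hμ => ?_, fun e he => ?_⟩
  · rw [hint μ hμ, sub_nonneg, ← le_div_iff₀ (by linarith [(hψi μ hμ).1])]
    exact csInf_le hbdd ⟨μ, hμ, rfl⟩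
  -- Attainment of the infimum is not needed: a ratio below β + e/M suffices.
  · obtain ⟨μ₀, hμ₀⟩ := hne
    have hM : 0 < M := by linarith [(hψi μ₀ hμ₀).1, (hψi μ₀ hμ₀).2]
    obtain ⟨_, ⟨μ, hμ, rfl⟩, hlt⟩ := exists_lt_of_csInf_lt (Set.Nonempty.image _ ⟨μ₀, hμ₀⟩)
      (show sInf ((fun ν : Measure X => (∫ x, u x ∂ν) / ∫ x, ψ x ∂ν) '' invariantMeasures T) <
        β + e / M from lt_add_of_pos_right _ (by positivity))
    refine ⟨μ, hμ, ?_⟩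
    obtain ⟨h1, h2⟩ := hψi μ hμ
    simp only at hlt
    rw [div_lt_iff₀ (by linarith)] at hlt
    rw [hint μ hμ]
    have : e / M * ∫ x, ψ x ∂μ ≤ e := by
      rw [div_mul_eq_mul_div, div_le_iff₀ hM]; gcongr
    linarith

/-- A continuous nonnegative function whose integrals against invariant measures have infimum `0`
vanishes along some orbit. -/
theorem exists_forall_iterate_eq_zero [Nonempty X] (hT : Continuous T) {G : X → ℝ}
    (hG : Continuous G) (hG0 : ∀ x, 0 ≤ G x)
    (hinf : ∀ e : ℝ, 0 < e → ∃ μ ∈ invariantMeasures T, ∫ x, G x ∂μ < e) :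
    ∃ x, ∀ i, G (T^[i] x) = 0 := by
  by_contra! hno
  obtain ⟨t, ht⟩ := isCompact_univ.elim_finite_subcover (fun i : ℕ => {x | 0 < G (T^[i] x)})
    (fun i => isOpen_lt continuous_const (hG.comp (hT.iterate i)))
    (fun x _ => by
      obtain ⟨i, hi⟩ := hno x
      exact mem_iUnion.2 ⟨i, lt_of_le_of_ne (hG0 _) hi.symm⟩)
  -- Every orbit meets {G > 0} before time N, so the N-step sums are bounded below by some c > 0,
  -- forcing ∫G ≥ c/N for every invariant measure.
  set N := t.sup id + 1
  have hpos : ∀ x, 0 < birkhoffSum T G N x := by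
    intro x
    obtain ⟨i, hi, hx⟩ := mem_iUnion₂.1 (ht (mem_univ x))
    refine Finset.sum_pos' (fun k _ => hG0 _) ⟨i, Finset.mem_range.2 ?_, hx⟩
    exact Nat.lt_succ_of_le (Finset.le_sup (f := id) hi)
  obtain ⟨c, _, hc, hcle, -⟩ := exists_bounds_of_pos (continuous_birkhoffSum hT hG N) hpos
  obtain ⟨μ, hμ, hlt⟩ := hinf (c / N) (by positivity)
  have := hμ.1
  have h1 := le_integral_of_le (μ := μ) (continuous_birkhoffSum hT hG N) hcle
  rw [integral_birkhoffSum hμ.2 hT hG] at h1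
  rw [lt_div_iff₀ (by positivity)] at hlt
  linarith

end Core

/-! ### The perturbation theorem. -/

section Perturbation

open Filter Topology Set Function

variable {X : Type*} [MetricSpace X] [CompactSpace X] [Nonempty X] [MeasurableSpace X]
  [BorelSpace X] {T : X → X} {ψ : X → ℝ}

/-- The Mañé–Conze–Guivarc'h–Bousch property normalizes the ratio minimization problem: up to a
coboundary, `u - β(u; ψ) ψ` is nonnegative and vanishes along some orbit. -/
theorem IsAdmissible.exists_nonneg_cohomologous (h : IsAdmissible T ψ) {α : ℝ≥0} (hα : 0 < α)
    (hα1 : α ≤ 1) (hψ : MemHolder α ψ) {u : X → ℝ} (hu : MemHolder α u) :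
    ∃ (β : ℝ) (G : X → ℝ), MemHolder α G ∧ (∀ x, 0 ≤ G x) ∧ (∃ x, ∀ i, G (T^[i] x) = 0) ∧
      ∀ μ ∈ invariantMeasures T, ∫ x, G x ∂μ = ∫ x, u x ∂μ - β * ∫ x, ψ x ∂μ := by
  obtain ⟨κ, hκ⟩ := h.lipschitz
  have hTc := hκ.continuous
  set β := ratioMinErgodicAverage T u ψ
  set w : X → ℝ := fun x => u x - β * ψ x with hw
  have hwH : MemHolder α w := by
    have : w = u + (-β) • ψ := by funext x; simp [hw]; ring
    rw [this]
    exact hu.add hψ.smul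
  have hwc := hwH.continuous hα
  obtain ⟨hnn, hinf⟩ := integral_sub_ratioMin (h.asp.nonempty_invariantMeasures hTc)
    (hu.continuous hα) h.continuous_weight h.weight_pos
  have hmin : minErgodicAverage T w = 0 := by
    refine le_antisymm ?_ (le_csInf ((h.asp.nonempty_invariantMeasures hTc).image _) ?_)
    · refine le_of_forall_pos_le_add fun e he => ?_
      obtain ⟨μ, hμ, hlt⟩ := hinf e he
      rw [zero_add]
      refine le_trans (csInf_le ⟨0, ?_⟩ ⟨μ, hμ, rfl⟩) hlt.le
      rintro _ ⟨ν, hν, rfl⟩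
      exact hnn ν hν
    · rintro _ ⟨ν, hν, rfl⟩
      exact hnn ν hν
  obtain ⟨K, hK, hKv⟩ := h.mcgbp α hα hα1
  obtain ⟨v, hv, hvG⟩ := hKv w hwH
  set G : X → ℝ := fun x => birkhoffAverage ℝ T w K x - v (T^[K] x) + v x with hG
  have hGH : MemHolder α G := by
    have : G = birkhoffAverage ℝ T w K + (-1 : ℝ) • (v ∘ T^[K]) + v := by
      funext x; simp [hG]; ring
    rw [this]
    exact ((hwH.birkhoffAverage hκ K).add (hv.comp_lipschitz (hκ.iterate K)).smul).add hv
  have hG0 : ∀ x, 0 ≤ G x := fun x => by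
    have := hvG x
    rw [hmin, sub_zero] at this
    exact this
  have hGint : ∀ μ ∈ invariantMeasures T, ∫ x, G x ∂μ = ∫ x, w x ∂μ := by
    intro μ hμ
    have := hμ.1
    have hvc := hv.continuous hα
    have h1 : Integrable (fun x => birkhoffAverage ℝ T w K x) μ :=
      integrable_of_continuous ((hwH.birkhoffAverage hκ K).continuous hα)
    have h2 : Integrable (fun x => v (T^[K] x)) μ :=
      integrable_of_continuous (hvc.comp (hTc.iterate K))
    have h3 : Integrable (fun x => birkhoffAverage ℝ T w K x - v (T^[K] x)) μ := h1.sub h2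
    simp only [hG]
    rw [integral_add h3 (integrable_of_continuous hvc), integral_sub h1 h2,
      integral_birkhoffAverage hμ.2 hTc hwc hK, integral_comp_iterate hμ.2 hvc]
    ring
  refine ⟨β, G, hGH, hG0, exists_forall_iterate_eq_zero hTc (hGH.continuous hα) hG0 ?_, ?_⟩
  · intro e he
    obtain ⟨μ, hμ, hlt⟩ := hinf e he
    exact ⟨μ, hμ, by rw [hGint μ hμ]; exact hlt⟩
  · intro μ hμ
    have := hμ.1
    rw [hGint μ hμ, hw, integral_sub (integrable_of_continuous (hu.continuous hα))
      ((integrable_of_continuous h.continuous_weight).const_mul β), integral_const_mul]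

set_option maxHeartbeats 1000000 in
/-- The main perturbation result: adding to `u` a Hölder function which, up to a small error,
dominates the distance to a suitable periodic orbit makes that orbit uniquely minimizing. -/
theorem IsAdmissible.exists_orbit_uniquely_minimizing (h : IsAdmissible T ψ) {α : ℝ≥0}
    (hα : 0 < α) (hα1 : α ≤ 1) (hψ : MemHolder α ψ) {u : X → ℝ} (hu : MemHolder α u) {ε H : ℝ}
    (hε : 0 < ε) (hH : 0 ≤ H) :
    ∃ z ∈ periodicPts T, ∃ c : ℝ, 0 < c ∧ ∀ g : X → ℝ,
      (∀ x y, |g x - g y| ≤ H * dist x y ^ (α : ℝ)) →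
      (∀ x, ε * Metric.infDist x (orbit T z) ^ (α : ℝ) - c ≤ g x) →
      (∀ y ∈ orbit T z, g y ≤ c) →
      UniquelyPeriodicallyMinimized T (fun x => u x + g x) ψ := by
  have hα' : (0 : ℝ) < α := hα
  have hα1' : (α : ℝ) ≤ 1 := hα1
  obtain ⟨κ, hκ⟩ := h.lipschitz
  have hTc := hκ.continuous
  have huc := hu.continuous hα
  have hψc := h.continuous_weight
  obtain ⟨β, G, hGH, hG0, ⟨x₀, hx₀⟩, hGint⟩ := h.exists_nonneg_cohomologous hα hα1 hψ hu
  have hGc := hGH.continuous hα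
  obtain ⟨HG, hHG, hGle⟩ := hGH.exists_abs_sub_le
  obtain ⟨Hψ, hHψ, hψle⟩ := hψ.exists_abs_sub_le
  obtain ⟨m, M, hm, hmψ, hψM⟩ := exists_bounds_of_pos hψc h.weight_pos
  have hmM : m ≤ M := (hmψ x₀).trans (hψM x₀)
  have hM : 0 < M := hm.trans_le hmM
  set Z : Set X := {x | ∀ i, G (T^[i] x) = 0} with hZ
  have hZne : Z.Nonempty := ⟨x₀, hx₀⟩
  have hZT : MapsTo T Z Z := fun x hx i => by
    rw [← iterate_succ_apply]; exact hx (i + 1)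
  have hZc : IsCompact Z := by
    refine IsClosed.isCompact ?_
    rw [hZ, ofPred_forall]
    exact isClosed_iInter fun i => isClosed_eq (hGc.comp (hTc.iterate i)) continuous_const
  have hGZ : ∀ x, G x ≤ HG * Metric.infDist x Z ^ (α : ℝ) := by
    intro x
    obtain ⟨y, hy, hxy⟩ := hZc.exists_infDist_eq_dist hZne x
    have h1 := (abs_le.1 (hGle x y)).2
    have h2 : G y = 0 := hy 0
    rw [hxy]
    linarith
  obtain ⟨δ, C, L, hδ, hC, -, hasp, -⟩ := h.asp.exists_sum_le hα'
  -- The constants up to P precede the orbit and g, and depend on neither. B will bound |b|, HF is a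
  -- Hölder constant for F, A₀·s/q bounds the negative part of F, and A₁·s bounds the left side of
  -- the balance condition; P makes that condition hold with ρ = D/(3 + κ).
  set Ψ := M / m with hΨ
  have hΨ0 : 0 < Ψ := by positivity
  set A₀ := 1 + Ψ * HG with hA₀
  have hA₀0 : 0 < A₀ := by positivity
  set B := (HG + 1) / m with hB
  have hB0 : 0 < B := by positivity
  set HF := HG + H + B * Hψ + ε / 2 with hHF
  have hHF0 : 0 < HF := by positivity
  set A₁ := A₀ + HF * (C * (A₀ / (ε / 2))) + A₀ with hA₁
  have hA₁0 : 0 < A₁ := by positivity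
  set P := A₁ * (3 + κ) ^ (α : ℝ) / (ε / 2) with hP
  have hP0 : 0 < P := by positivity
  -- The bound s ≤ 1 yields |b| ≤ B; the other entry of the minimum yields D ≤ δ.
  obtain ⟨z, hz, s, D, hs, hsle, hD, hDα, hS, hsep⟩ := h.asp.exists_separated_orbit hZne hZT hα'
    hα1' hP0 (show 0 < min 1 (δ ^ (α : ℝ) / P) by positivity)
  have hs1 : s ≤ 1 := hsle.trans (min_le_left _ _)
  have hDδ : D ≤ δ := by
    rw [← Real.rpow_le_rpow_iff hD.le hδ.le hα', hDα]
    have h1 := hsle.trans (min_le_right _ _)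
    rw [le_div_iff₀ hP0] at h1
    linarith
  have hOmem := orbitMeasure_mem_invariantMeasures hTc hz
  have hOprob := hOmem.1
  set q : ℝ := (minimalPeriod T z : ℝ) with hq
  have hq1 : 1 ≤ q := Nat.one_le_cast.2 (minimalPeriod_pos_of_mem_periodicPts hz)
  have hq0 : 0 < q := by linarith
  -- The margin enters F once through g and again, multiplied by at most Ψ, through b; c(1 + Ψ) =
  -- s/q is its share of R.
  set c := s / (q * (1 + Ψ)) with hc
  have hc0 : 0 < c := by positivity
  refine ⟨z, hz, c, hc0, fun g hgH hglow hgup => ?_⟩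
  have hgc : Continuous g := (HolderWith.of_abs_sub_le hH hgH).continuous hα
  set O := orbit T z with hO
  have hglow' : ∀ x, -c ≤ g x := fun x => by
    have h1 : 0 ≤ ε * Metric.infDist x O ^ (α : ℝ) :=
      mul_nonneg hε.le (Real.rpow_nonneg Metric.infDist_nonneg _)
    have := hglow x
    linarith
  -- averages over the periodic orbit
  set IG := ∫ x, G x ∂orbitMeasure T z with hIG
  set Ig := ∫ x, g x ∂orbitMeasure T z with hIg
  set Iψ := ∫ x, ψ x ∂orbitMeasure T z with hIψ
  have hIψm : m ≤ Iψ := le_integral_of_le hψc hmψ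
  have hIψ0 : 0 < Iψ := hm.trans_le hIψm
  have hIG0 : 0 ≤ IG := integral_nonneg hG0
  have hIGs : IG ≤ HG * s / q := by
    rw [hIG, integral_orbitMeasure]
    gcongr
    calc ∑ k ∈ Finset.range (minimalPeriod T z), G (T^[k] z)
        ≤ ∑ k ∈ Finset.range (minimalPeriod T z), HG * Metric.infDist (T^[k] z) Z ^ (α : ℝ) :=
          Finset.sum_le_sum fun k _ => hGZ _
      _ ≤ HG * s := by rw [← Finset.mul_sum]; gcongr
  have hIglow : -c ≤ Ig := le_integral_of_le hgc hglow'
  have hIgup : Ig ≤ c := by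
    rw [hIg, integral_orbitMeasure, div_le_iff₀ hq0]
    calc ∑ k ∈ Finset.range (minimalPeriod T z), g (T^[k] z)
        ≤ ∑ k ∈ Finset.range (minimalPeriod T z), c :=
          Finset.sum_le_sum fun k _ => hgup _ ⟨k, rfl⟩
      _ = c * q := by simp [hq, mul_comm]
  -- This choice gives F zero sum over the orbit, and β + b becomes the ratio minimum of u + g.
  set b := (IG + Ig) / Iψ with hb
  have hbIψ : b * Iψ = IG + Ig := div_mul_cancel₀ _ hIψ0.ne'
  set R := A₀ * s / q with hR
  have hR0 : 0 < R := by positivity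
  have hbabs : |b| ≤ (HG * s / q + c) / m := by
    rw [hb, abs_div, abs_of_pos hIψ0]
    gcongr
    rw [abs_le]
    constructor <;> linarith
  have hcs : c ≤ s / q := by
    rw [hc]
    gcongr
    nlinarith
  have hbB : |b| ≤ B := by
    refine hbabs.trans (div_le_div_of_nonneg_right ?_ hm.le)
    calc HG * s / q + c ≤ HG * s / q + s / q := by gcongr
      _ = (HG + 1) * (s / q) := by ring
      _ ≤ (HG + 1) * 1 := by
        gcongr
        rw [div_le_one hq0]
        linarith
      _ = HG + 1 := mul_one _
  have hcR : c + |b| * M ≤ R := by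
    calc c + |b| * M ≤ c + (HG * s / q + c) / m * M := by gcongr
      _ = c * (1 + Ψ) + Ψ * HG * s / q := by rw [hΨ]; ring
      _ = s / q + Ψ * HG * s / q := by rw [hc]; field_simp
      _ = R := by rw [hR, hA₀]; ring
  have hbψ : ∀ x, b * ψ x ≤ |b| * M := fun x =>
    mul_le_mul (le_abs_self b) (hψM x) (h.weight_pos x).le (abs_nonneg b)
  -- the function whose Birkhoff sums are bounded below
  set F : X → ℝ := fun x => G x + g x - b * ψ x - ε / 2 * Metric.infDist x O ^ (α : ℝ) with hF
  have hdc : Continuous fun x => Metric.infDist x O ^ (α : ℝ) := continuous_infDist_rpow O hα'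
  have hFc : Continuous F := ((hGc.add hgc).sub (hψc.const_mul b)).sub (hdc.const_mul _)
  have hFint : ∀ μ ∈ invariantMeasures T, ∫ x, F x ∂μ = ∫ x, G x ∂μ + ∫ x, g x ∂μ -
      b * ∫ x, ψ x ∂μ - ε / 2 * ∫ x, Metric.infDist x O ^ (α : ℝ) ∂μ := by
    intro μ hμ
    have := hμ.1
    have h1 : Integrable (fun x => G x + g x - b * ψ x) μ :=
      integrable_of_continuous ((hGc.add hgc).sub (hψc.const_mul b))
    have h2 : Integrable (fun x => G x + g x) μ := integrable_of_continuous (hGc.add hgc)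
    simp only [hF]
    rw [integral_sub h1 (integrable_of_continuous (hdc.const_mul _)),
      integral_sub h2 (integrable_of_continuous (hψc.const_mul b)),
      integral_add (integrable_of_continuous hGc) (integrable_of_continuous hgc),
      integral_const_mul, integral_const_mul]
  have hdist0 : ∫ x, Metric.infDist x O ^ (α : ℝ) ∂orbitMeasure T z = 0 := by
    rw [integral_orbitMeasure]
    have : ∀ k, Metric.infDist (T^[k] z) O ^ (α : ℝ) = 0 := fun k => by
      rw [Metric.infDist_zero_of_mem (show T^[k] z ∈ O from ⟨k, rfl⟩), Real.zero_rpow hα'.ne']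
    simp [this]
  -- Half of the penalty ε·d^α stays in F for the lower bound; the half subtracted from F later
  -- forces uniqueness.
  obtain ⟨A, hA⟩ := exists_le_birkhoffSum hκ hz (α := α) (δ := δ) (C := C) (ε := ε / 2) (R := R)
    (H := HF) (D := D) (ρ := D / (3 + κ)) (F := F) hα' (by positivity) hR0.le hHF0.le hC.le hasp
    hsep
    (by
      intro x
      have h1 := hglow x
      have h2 := hbψ x
      have h3 := hG0 x
      simp only [hF]
      linarith)
    (by
      intro x y
      have h1 := (abs_le.1 (hGle x y)).1
      have h2 := (abs_le.1 (hgH x y)).1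
      have h3 : b * (ψ x - ψ y) ≤ B * (Hψ * dist x y ^ (α : ℝ)) := by
        refine (le_abs_self _).trans ?_
        rw [abs_mul]
        exact mul_le_mul hbB (hψle x y) (abs_nonneg _) hB0.le
      have h4 := (abs_le.1 (abs_infDist_rpow_sub_le (Z := O) hα' hα1' x y)).2
      have h5 : ε / 2 * (Metric.infDist x O ^ (α : ℝ) - Metric.infDist y O ^ (α : ℝ)) ≤
          ε / 2 * dist x y ^ (α : ℝ) := by gcongr
      simp only [hF, hHF]
      linarith)
    (by
      have h1 := hFint _ hOmem
      rw [hdist0, mul_zero, sub_zero, integral_orbitMeasure, ← hIG, ← hIg, ← hIψ, hbIψ, sub_self]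
        at h1
      rcases div_eq_zero_iff.1 h1 with h2 | h2
      · exact h2
      · exact (hq0.ne' h2).elim)
    (by positivity)
    (by
      rw [mul_div_assoc', div_lt_iff₀ (by positivity)]
      nlinarith)
    (by
      refine le_trans (div_le_self hD.le ?_) hDδ
      have : (0 : ℝ) ≤ κ := κ.2
      linarith)
    (by
      rw [Real.div_rpow hD.le (by positivity), hDα, hP, ← hq]
      have h1 : R ≤ A₀ * s := div_le_self (by positivity) hq1
      have h2 : q * R = A₀ * s := by rw [hR]; field_simp
      have h3 : (3 + κ : ℝ) ^ (α : ℝ) ≠ 0 := by positivity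
      calc q * R + HF * (C * (R / (ε / 2))) + R
          ≤ A₀ * s + HF * (C * (A₀ * s / (ε / 2))) + A₀ * s := by rw [h2]; gcongr
        _ = A₁ * s := by rw [hA₁]; ring
        _ = ε / 2 * (A₁ * (3 + κ) ^ (α : ℝ) / (ε / 2) * s / (3 + κ) ^ (α : ℝ)) := by
          field_simp)
  have hadd : ∀ μ ∈ invariantMeasures T,
      ∫ x, (u x + g x) ∂μ = ∫ x, u x ∂μ + ∫ x, g x ∂μ := by
    intro μ hμ
    have := hμ.1
    exact integral_add (integrable_of_continuous huc) (integrable_of_continuous hgc)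
  refine uniquelyPeriodicallyMinimized_of_integral_le hTc hz hψc h.weight_pos hα'
    (ε := ε / 2) (b := β + b) (by positivity) ?_ ?_
  · have h1 := hGint _ hOmem
    rw [hadd _ hOmem, add_mul, ← hIψ, hbIψ, ← hIg, hIG, h1]
    ring
  · intro μ hμ
    have h1 := integral_nonneg_of_birkhoffSum hμ hTc hFc hA
    rw [hFint μ hμ, hGint μ hμ] at h1
    rw [hadd μ hμ]
    linarith

end Perturbation

/-! ### Density and openness in the Hölder space. -/

section HolderDensity

open Filter Topology Set Function

variable {X : Type*} [MetricSpace X] [CompactSpace X] {α : ℝ≥0}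

theorem HolderSpace.abs_apply_le (w : HolderSpace X α) (x : X) : |w x| ≤ ‖w‖ := by
  rw [HolderSpace.norm_def]
  have h1 : |w x| ≤ ‖w.toC‖ := w.toC.norm_coe_le_norm x
  have := (nnHolderNorm α w).2
  linarith

theorem HolderSpace.abs_sub_le (w : HolderSpace X α) (x y : X) :
    |w x - w y| ≤ ‖w‖ * dist x y ^ (α : ℝ) := by
  have h1 := w.memHolder.holderWith.dist_le x y
  rw [Real.dist_eq] at h1
  refine h1.trans ?_
  gcongr
  rw [HolderSpace.norm_def]
  linarith [norm_nonneg w.toC]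

/-- A Hölder function, as an element of the Hölder space. -/
def HolderSpace.mk (u : X → ℝ) (hc : Continuous u) (hu : MemHolder α u) : HolderSpace X α :=
  (⟨⟨u, hc⟩, hu⟩ : holderSubmodule X α)

theorem HolderSpace.norm_mk_le {u : X → ℝ} (hc : Continuous u) {A H : ℝ} (hA : 0 ≤ A) (hH : 0 ≤ H)
    (h1 : ∀ x, |u x| ≤ A) (h2 : ∀ x y, |u x - u y| ≤ H * dist x y ^ (α : ℝ)) :
    ‖HolderSpace.mk u hc (HolderWith.of_abs_sub_le hH h2).memHolder‖ ≤ A + H := by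
  rw [HolderSpace.norm_def]
  refine add_le_add ((ContinuousMap.norm_le _ hA).2 h1) ?_
  have h3 := (HolderWith.of_abs_sub_le hH h2).nnholderNorm_le
  calc _ ≤ (H.toNNReal : ℝ) := NNReal.coe_le_coe.2 h3
    _ = H := Real.coe_toNNReal H hH

variable [Nonempty X] [MeasurableSpace X] [BorelSpace X] {T : X → X} {ψ : X → ℝ}

/-- Near each u, the function u + ε·d(·,O)^α is an interior point of the good set: the margin c
absorbs every further perturbation of norm below `min c 1`. -/
theorem IsAdmissible.exists_dense_holder (h : IsAdmissible T ψ) (hα : 0 < α) (hα1 : α ≤ 1)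
    (hψ : MemHolder α ψ) :
    ∃ P : Set (HolderSpace X α), IsOpen P ∧ Dense P ∧
      ∀ u ∈ P, UniquelyPeriodicallyMinimized T u ψ := by
  have hα' : (0 : ℝ) < α := hα
  refine ⟨interior {u | UniquelyPeriodicallyMinimized T u ψ}, isOpen_interior, ?_,
    fun u hu => (interior_subset hu : u ∈ {u | _})⟩
  rw [Metric.dense_iff]
  intro u r hr
  set Δ : ℝ := Metric.diam (univ : Set X) ^ (α : ℝ) with hΔ
  have hΔ0 : 0 ≤ Δ := Real.rpow_nonneg Metric.diam_nonneg _
  set ε : ℝ := r / (2 * (Δ + 1)) with hε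
  have hε0 : 0 < ε := by positivity
  -- The constant ε + 1 must be fixed before the orbit is known; it covers ε·d^α plus any
  -- perturbation of norm at most 1.
  obtain ⟨z, -, c, hc, hz⟩ := h.exists_orbit_uniquely_minimizing hα hα1 hψ u.memHolder hε0
    (show (0 : ℝ) ≤ ε + 1 by positivity)
  set O := orbit T z with hO
  set d : X → ℝ := fun x => ε * Metric.infDist x O ^ (α : ℝ) with hd
  have hdc : Continuous d := continuous_const.mul (continuous_infDist_rpow O hα')
  have hd0 : ∀ x, 0 ≤ d x := fun x =>
    mul_nonneg hε0.le (Real.rpow_nonneg Metric.infDist_nonneg _)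
  have hdle : ∀ x, |d x| ≤ ε * Δ := fun x => by
    rw [abs_of_nonneg (hd0 x)]
    refine mul_le_mul_of_nonneg_left
      (Real.rpow_le_rpow Metric.infDist_nonneg ?_ hα'.le) hε0.le
    exact (Metric.infDist_le_dist_of_mem (show z ∈ O from ⟨0, rfl⟩)).trans
      (Metric.dist_le_diam_of_mem isCompact_univ.isBounded (mem_univ _) (mem_univ _))
  have hdH : ∀ x y, |d x - d y| ≤ ε * dist x y ^ (α : ℝ) := fun x y => by
    simp only [hd]
    rw [← mul_sub, abs_mul, abs_of_pos hε0]
    exact mul_le_mul_of_nonneg_left (abs_infDist_rpow_sub_le hα' hα1 x y) hε0.le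
  set e : HolderSpace X α := HolderSpace.mk d hdc (HolderWith.of_abs_sub_le hε0.le hdH).memHolder
  have he : ‖e‖ ≤ ε * Δ + ε := HolderSpace.norm_mk_le hdc (by positivity) hε0.le hdle hdH
  refine ⟨u + e, ?_, mem_interior.2 ⟨Metric.ball (u + e) (min c 1), ?_, Metric.isOpen_ball,
    Metric.mem_ball_self (by positivity)⟩⟩
  · rw [Metric.mem_ball, dist_eq_norm, add_sub_cancel_left]
    calc ‖e‖ ≤ ε * Δ + ε := he
      _ = r / 2 := by rw [hε]; field_simp
      _ < r := half_lt_self hr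
  · intro u' hu'
    rw [Metric.mem_ball, dist_eq_norm] at hu'
    set w := u' - (u + e) with hw
    have hwc : ‖w‖ ≤ c := hu'.le.trans (min_le_left _ _)
    have hw1 : ‖w‖ ≤ 1 := hu'.le.trans (min_le_right _ _)
    have key := hz (fun x => d x + w x) ?_ ?_ ?_
    · have : (fun x => u x + (d x + w x)) = u' := by
        funext x
        have h1 : u + e + w = u' := by rw [hw]; abel
        rw [← h1, ← add_assoc]
        rfl
      rwa [this] at key
    · intro x y
      have h1 := hdH x y
      have h2 := w.abs_sub_le x y
      have h3 : ‖w‖ * dist x y ^ (α : ℝ) ≤ 1 * dist x y ^ (α : ℝ) := by gcongr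
      calc |d x + w x - (d y + w y)| = |(d x - d y) + (w x - w y)| := by congr 1; ring
        _ ≤ |d x - d y| + |w x - w y| := abs_add_le _ _
        _ ≤ (ε + 1) * dist x y ^ (α : ℝ) := by linarith
    · intro x
      have := (abs_le.1 ((w.abs_apply_le x).trans hwc)).1
      simp only [hd]
      linarith
    · intro y hy
      have := (abs_le.1 ((w.abs_apply_le y).trans hwc)).2
      simp only [hd]
      rw [Metric.infDist_zero_of_mem hy, Real.zero_rpow hα'.ne', mul_zero, zero_add]
      exact this

end HolderDensity

/-! ### Riemannian distance versus chart distance. -/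

section ChartComparison

open Filter Topology Set Function Manifold Metric
open scoped ENNReal

variable {E : Type*} [NormedAddCommGroup E] [NormedSpace ℝ E]
  {H : Type*} [TopologicalSpace H] (I : ModelWithCorners ℝ E H)
  {M : Type*} [TopologicalSpace M] [ChartedSpace H M]
  [Bundle.RiemannianBundle (fun x : M => TangentSpace I x)]
  [IsManifold I 1 M] [IsContinuousRiemannianBundle E (fun x : M => TangentSpace I x)]

attribute [local instance] normedAddCommGroupTangentSpaceVectorSpace
attribute [local instance] normedSpaceTangentSpaceVectorSpace

/-- Near any point, the Riemannian distance is controlled by the distance in the extended chart. -/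
theorem exists_nhds_riemannianEDist_le_edist_extChartAt (p : M) :
    ∃ C : ℝ≥0, ∃ U ∈ 𝓝 p, ∀ x ∈ U, ∀ y ∈ U,
      riemannianEDist I x y ≤ C * edist (extChartAt I p x) (extChartAt I p y) := by
  rcases eventually_enorm_mfderivWithin_symm_extChartAt_lt I p with ⟨C, C_pos, hC⟩
  obtain ⟨S, hS, hSC⟩ := eventually_iff_exists_mem.1 hC
  obtain ⟨r, r_pos, hr⟩ : ∃ r > 0,
      ball (extChartAt I p p) r ∩ range I ⊆ (extChartAt I p).target ∩ S :=
    mem_nhdsWithin_iff.1 (inter_mem (extChartAt_target_mem_nhdsWithin p) hS)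
  have A : (extChartAt I p) ⁻¹' (ball (extChartAt I p p) r ∩ range I) ∈ 𝓝 p := by
    apply extChartAt_preimage_mem_nhds_of_mem_nhdsWithin (by simp)
    rw [inter_comm]
    exact inter_mem_nhdsWithin _ (ball_mem_nhds _ r_pos)
  refine ⟨C, _, inter_mem A (chart_source_mem_nhds H p), ?_⟩
  rintro x ⟨hx, h'x⟩ y ⟨hy, h'y⟩
  -- The test path is a straight segment in the chart; convexity keeps it where the inverse chart
  -- has derivative bounded by C.
  let η := ContinuousAffineMap.lineMap (R := ℝ) (extChartAt I p x) (extChartAt I p y)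
  set γ := (extChartAt I p).symm ∘ η
  have hη : Icc 0 1 ⊆ ⇑η ⁻¹' ((extChartAt I p).target ∩ S) := by
    simp only [← image_subset_iff, ContinuousAffineMap.coe_lineMap_eq,
     ← segment_eq_image_lineMap, η]
    apply Subset.trans _ hr
    exact ((convex_ball _ _).inter I.convex_range).segment_subset hx hy
  simp only [preimage_inter, subset_inter_iff] at hη
  have η_smooth : ContMDiffOn 𝓘(ℝ, ℝ) 𝓘(ℝ, E) 1 η (Icc 0 1) := by
    apply ContMDiff.contMDiffOn
    rw [contMDiff_iff_contDiff]
    exact ContinuousAffineMap.contDiff _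
  have : riemannianEDist I x y ≤ pathELength I γ 0 1 := by
    apply riemannianEDist_le_pathELength _ _ _ zero_le_one
    · exact (contMDiffOn_extChartAt_symm p).comp η_smooth hη.1
    · simp [γ, η, ContinuousAffineMap.coe_lineMap_eq, h'x]
    · simp [γ, η, ContinuousAffineMap.coe_lineMap_eq, h'y]
  apply this.trans
  rw [← lintegral_fderiv_lineMap_eq_edist, pathELength_eq_lintegral_mfderivWithin_Icc,
    ← lintegral_const_mul' _ _ ENNReal.coe_ne_top]
  apply setLIntegral_mono' measurableSet_Icc (fun t ht ↦ ?_)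
  have : mfderivWithin 𝓘(ℝ, ℝ) I γ (Icc 0 1) t =
      (mfderivWithin 𝓘(ℝ, E) I (extChartAt I p).symm (range I) (η t)) ∘L
        (mfderivWithin 𝓘(ℝ, ℝ) 𝓘(ℝ, E) η (Icc 0 1) t) := by
    apply mfderivWithin_comp
    · exact mdifferentiableWithinAt_extChartAt_symm (hη.1 ht)
    · exact η_smooth.mdifferentiableOn one_ne_zero t ht
    · exact hη.1.trans (preimage_mono (extChartAt_target_subset_range p))
    · rw [uniqueMDiffWithinAt_iff_uniqueDiffWithinAt]
      exact uniqueDiffOn_Icc zero_lt_one t ht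
  have : mfderivWithin 𝓘(ℝ, ℝ) I γ (Icc 0 1) t 1 =
      (mfderivWithin 𝓘(ℝ, E) I (extChartAt I p).symm (range I) (η t))
        (mfderivWithin 𝓘(ℝ, ℝ) 𝓘(ℝ, E) η (Icc 0 1) t 1) := congr($this 1)
  rw [this]
  apply (ContinuousLinearMap.le_opENorm _ _).trans
  gcongr
  · exact (hSC _ (hη.2 ht)).le
  · simp only [mfderivWithin_eq_fderivWithin]
    exact le_of_eq rfl

end ChartComparison

/-! ### Lipschitz bounds from differentials. -/

section Riemannian

open Filter Topology Set Function Manifold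
open scoped ENNReal

variable {n : ℕ} {M : Type*} [MetricSpace M] [ChartedSpace (EuclideanSpace ℝ (Fin n)) M]
  [Bundle.RiemannianBundle (fun x : M => TangentSpace (𝓡 n) x)]

theorem enorm_differential_le (u : M → ℝ) (x : M) {B : ℝ≥0} (hB : ‖differential n u x‖ ≤ B)
    (v : TangentSpace (𝓡 n) x) : ‖differential n u x v‖ₑ ≤ B * ‖v‖ₑ := by
  have h1 : ‖differential n u x v‖ ≤ B * ‖v‖ :=
    (ContinuousLinearMap.le_opNorm _ v).trans (by gcongr)
  have h2 : ‖differential n u x v‖₊ ≤ B * ‖v‖₊ := h1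
  rw [enorm_eq_nnnorm, enorm_eq_nnnorm]
  exact_mod_cast h2


/-- A bound on the differential gives a Lipschitz bound for the Riemannian distance. -/
theorem COneSpace.enorm_sub_le (u : COneSpace n M) {B : ℝ≥0}
    (hB : ∀ x, ‖differential n u x‖ ≤ B) (x y : M) (hxy : riemannianEDist (𝓡 n) x y ≠ ⊤) :
    ‖u y - u x‖ₑ ≤ B * riemannianEDist (𝓡 n) x y := by
  refine ENNReal.le_of_forall_pos_le_add fun ε hε _ => ?_
  -- Dividing by B + 1 rather than B covers B = 0.
  have hlt : riemannianEDist (𝓡 n) x y < riemannianEDist (𝓡 n) x y + (ε / (B + 1) : ℝ≥0) :=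
    ENNReal.lt_add_right hxy (by positivity)
  obtain ⟨γ, hγ0, hγ1, hγ, hlen⟩ := exists_lt_of_riemannianEDist_lt hlt
  have hu : ContMDiff (𝓡 n) 𝓘(ℝ, ℝ) 1 u := u.contMDiff
  have hC : ContMDiffOn 𝓘(ℝ, ℝ) 𝓘(ℝ, ℝ) 1 ((u : M → ℝ) ∘ γ) (Icc 0 1) := hu.comp_contMDiffOn hγ
  calc ‖u y - u x‖ₑ = ‖((u : M → ℝ) ∘ γ) 1 - ((u : M → ℝ) ∘ γ) 0‖ₑ := by simp [hγ0, hγ1]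
    _ ≤ ∫⁻ t in Icc (0 : ℝ) 1, ‖derivWithin ((u : M → ℝ) ∘ γ) (Icc 0 1) t‖ₑ :=
      enorm_sub_le_lintegral_derivWithin_Icc_of_contDiffOn_Icc
        (contMDiffOn_iff_contDiffOn.1 hC) zero_le_one
    _ ≤ ∫⁻ t in Icc (0 : ℝ) 1, B * ‖mfderivWithin 𝓘(ℝ, ℝ) (𝓡 n) γ (Icc 0 1) t 1‖ₑ := by
      refine setLIntegral_mono' measurableSet_Icc fun t ht => ?_
      have h1 : mfderivWithin 𝓘(ℝ, ℝ) 𝓘(ℝ, ℝ) ((u : M → ℝ) ∘ γ) (Icc 0 1) t =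
          (mfderiv (𝓡 n) 𝓘(ℝ, ℝ) u (γ t)) ∘L
            (mfderivWithin 𝓘(ℝ, ℝ) (𝓡 n) γ (Icc 0 1) t) := by
        apply mfderiv_comp_mfderivWithin
        · exact hu.mdifferentiable one_ne_zero _
        · exact hγ.mdifferentiableOn one_ne_zero _ ht
        · rw [uniqueMDiffWithinAt_iff_uniqueDiffWithinAt]
          exact uniqueDiffOn_Icc zero_lt_one _ ht
      have h2 : derivWithin ((u : M → ℝ) ∘ γ) (Icc 0 1) t =
          differential n u (γ t) (mfderivWithin 𝓘(ℝ, ℝ) (𝓡 n) γ (Icc 0 1) t 1) := by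
        rw [← fderivWithin_derivWithin, ← mfderivWithin_eq_fderivWithin, h1]
        rfl
      rw [h2]
      exact enorm_differential_le _ _ (hB _) _
    _ = B * pathELength (𝓡 n) γ 0 1 := by
      rw [lintegral_const_mul' _ _ ENNReal.coe_ne_top, pathELength_eq_lintegral_mfderivWithin_Icc]
    _ ≤ B * (riemannianEDist (𝓡 n) x y + (ε / (B + 1) : ℝ≥0)) := by gcongr
    _ ≤ B * riemannianEDist (𝓡 n) x y + ε := by
      rw [mul_add]
      gcongr
      rw [← ENNReal.coe_mul, ENNReal.coe_le_coe, ← mul_div_assoc]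
      refine div_le_of_le_mul₀ (by positivity) (by positivity) ?_
      rw [mul_comm]
      gcongr
      exact le_self_add

end Riemannian

/-! ### Mollification of Lipschitz functions. -/

section Smoothing

open Filter Topology Set Function
open scoped Convolution

/-- A Lipschitz function on a Euclidean space is a uniform limit of continuously differentiable
functions with the same Lipschitz constant. -/
theorem _root_.LipschitzWith.exists_contDiff_approx {E : Type*} [NormedAddCommGroup E]
    [InnerProductSpace ℝ E] [FiniteDimensional ℝ E] {f : E → ℝ} (hf : LipschitzWith 1 f) {τ : ℝ}
    (hτ : 0 < τ) :
    ∃ g : E → ℝ, ContDiff ℝ 1 g ∧ LipschitzWith 1 g ∧ ∀ x, |g x - f x| ≤ τ := by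
  borelize E
  set μ : Measure E := Measure.addHaar
  -- Convolution with a normalized bump of radius τ averages translates of f, so it keeps the
  -- Lipschitz constant and moves values by at most τ.
  set φ : ContDiffBump (0 : E) := ⟨τ / 2, τ, half_pos hτ, half_lt_self hτ⟩
  have hloc : LocallyIntegrable f μ := hf.continuous.locallyIntegrable
  refine ⟨φ.normed μ ⋆[ContinuousLinearMap.lsmul ℝ ℝ, μ] f,
    φ.hasCompactSupport_normed.contDiff_convolution_left _ φ.contDiff_normed hloc, ?_, ?_⟩
  · have hint : ∀ x, Integrable (fun t => φ.normed μ t * f (x - t)) μ := fun x =>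
      ((φ.continuous_normed (μ := μ)).mul (hf.continuous.comp (continuous_const.sub continuous_id))
        ).integrable_of_hasCompactSupport (φ.hasCompactSupport_normed (μ := μ)).mul_right
    refine LipschitzWith.of_dist_le_mul fun x y => ?_
    simp only [convolution, ContinuousLinearMap.lsmul_apply, smul_eq_mul]
    rw [Real.dist_eq, ← integral_sub (hint x) (hint y)]
    calc |∫ t, (φ.normed μ t * f (x - t) - φ.normed μ t * f (y - t)) ∂μ|
        ≤ ∫ t, φ.normed μ t * dist x y ∂μ := by
          rw [← Real.norm_eq_abs]
          refine norm_integral_le_of_norm_le ((φ.integrable_normed (μ := μ)).mul_const _)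
            (Eventually.of_forall fun t => ?_)
          rw [← mul_sub, norm_mul, Real.norm_of_nonneg (φ.nonneg_normed (μ := μ) t)]
          refine mul_le_mul_of_nonneg_left ?_ (φ.nonneg_normed (μ := μ) t)
          have := hf.dist_le_mul (x - t) (y - t)
          rwa [dist_sub_right, NNReal.coe_one, one_mul, dist_eq_norm] at this
      _ = ((1 : ℝ≥0) : ℝ) * dist x y := by
          rw [integral_mul_const, φ.integral_normed, NNReal.coe_one]
  · intro x
    rw [← Real.dist_eq]
    refine φ.dist_normed_convolution_le hf.continuous.aestronglyMeasurable fun y hy => ?_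
    have := hf.dist_le_mul y x
    rw [NNReal.coe_one, one_mul] at this
    exact this.trans (Metric.mem_ball.1 hy).le

end Smoothing

/-! ### Uniform estimates on the compact manifold. -/

section ManifoldBounds

open Filter Topology Set Function Manifold
open scoped ENNReal

theorem exists_forall_of_locally {Y : Type*} [TopologicalSpace Y] [CompactSpace Y]
    {R : ℝ → Y → Prop} (hmono : ∀ A B y, A ≤ B → R A y → R B y)
    (hloc : ∀ y, ∃ A, ∀ᶠ y' in 𝓝 y, R A y') : ∃ A, ∀ y, R A y := by
  have := isCompact_univ.induction_on (X := Y) (p := fun S => ∃ A, ∀ y ∈ S, R A y)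
    ⟨0, fun y hy => hy.elim⟩
    (fun S S' hSS' ⟨A, hA⟩ => ⟨A, fun y hy => hA y (hSS' hy)⟩)
    (fun S S' ⟨A, hA⟩ ⟨B, hB⟩ => ⟨max A B, fun y hy => hy.elim
      (fun h => hmono _ _ _ (le_max_left _ _) (hA y h))
      (fun h => hmono _ _ _ (le_max_right _ _) (hB y h))⟩)
    (fun y _ => by
      obtain ⟨A, hA⟩ := hloc y
      exact ⟨_, mem_nhdsWithin_of_mem_nhds hA, A, fun y' hy' => hy'⟩)
  obtain ⟨A, hA⟩ := this
  exact ⟨A, fun y => hA y (mem_univ y)⟩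

/-- An immersion is locally bounded below with respect to a chart. -/
theorem exists_nhds_dist_extChartAt_le {n : ℕ} {M : Type*} [TopologicalSpace M]
    [ChartedSpace (EuclideanSpace ℝ (Fin n)) M] [IsManifold (𝓡 n) 1 M]
    {E : Type*} [NormedAddCommGroup E] [NormedSpace ℝ E] {e : M → E}
    (he : ContMDiff (𝓡 n) 𝓘(ℝ, E) 1 e) (p : M)
    (hinj : Injective (mfderiv (𝓡 n) 𝓘(ℝ, E) e p)) :
    ∃ K : ℝ, 0 ≤ K ∧ ∃ U ∈ 𝓝 p, ∀ x ∈ U, ∀ y ∈ U,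
      dist (extChartAt (𝓡 n) p x) (extChartAt (𝓡 n) p y) ≤ K * dist (e x) (e y) := by
  set φ := extChartAt (𝓡 n) p with hφ
  set f : EuclideanSpace ℝ (Fin n) → E := e ∘ φ.symm with hf
  have hw : writtenInExtChartAt (𝓡 n) 𝓘(ℝ, E) p e = f := by
    simp only [writtenInExtChartAt, extChartAt_model_space_eq_id, hf, hφ]
    rfl
  have hfd : ContDiffAt ℝ 1 f (φ p) := by
    have h1 := (contMDiffAt_iff.1 (he p)).2
    rw [ModelWithCorners.range_eq_univ, contDiffWithinAt_univ] at h1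
    exact h1
  have hL : Injective (fderiv ℝ f (φ p)) := by
    rw [(he.mdifferentiable one_ne_zero p).mfderiv, hw, ModelWithCorners.range_eq_univ,
      fderivWithin_univ] at hinj
    exact hinj
  obtain ⟨K, hK0, hK⟩ := (fderiv ℝ f (φ p)).toLinearMap.exists_antilipschitzWith
    (LinearMap.ker_eq_bot.2 hL)
  -- Near the base point f differs from its derivative by a (2K)⁻¹-Lipschitz map. This uses up half
  -- of the expansion of the derivative, whence the constant 2K.
  obtain ⟨s, hs, happ⟩ := (hfd.hasStrictFDerivAt one_ne_zero).approximates_deriv_on_nhds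
    (c := (2 * K)⁻¹) (Or.inr (by positivity))
  refine ⟨2 * K, by positivity, φ.source ∩ φ ⁻¹' s, inter_mem (extChartAt_source_mem_nhds p)
    ((continuousAt_extChartAt p).preimage_mem_nhds hs), ?_⟩
  rintro x ⟨hx, hxs⟩ y ⟨hy, hys⟩
  have h1 := happ (φ x) hxs (φ y) hys
  have h2 : f (φ x) = e x := by simp only [hf, comp_apply, φ.left_inv hx]
  have h3 : f (φ y) = e y := by simp only [hf, comp_apply, φ.left_inv hy]
  have h4 := hK.le_mul_dist (φ x) (φ y)
  rw [h2, h3] at h1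
  simp only [ContinuousLinearMap.coe_coe] at h4
  rw [dist_eq_norm (fderiv ℝ f (φ p) (φ x)), ← map_sub] at h4
  rw [dist_eq_norm, dist_eq_norm] at *
  set a := ‖φ x - φ y‖
  set w := fderiv ℝ f (φ p) (φ x - φ y)
  have h5 : ‖w‖ ≤ ‖e x - e y‖ + ‖e x - e y - w‖ := by
    have := norm_sub_le (e x - e y) (e x - e y - w)
    rwa [sub_sub_cancel] at this
  have hK0' : (0 : ℝ) < K := hK0
  have h6 : (K : ℝ) * ‖w‖ ≤ K * (‖e x - e y‖ + (2 * (K : ℝ))⁻¹ * a) := by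
    refine mul_le_mul_of_nonneg_left (h5.trans ?_) hK0'.le
    have : ‖e x - e y - w‖ ≤ (2 * (K : ℝ))⁻¹ * a := by
      refine h1.trans (le_of_eq ?_)
      push_cast
      rfl
    linarith
  have h7 : (K : ℝ) * ((2 * (K : ℝ))⁻¹ * a) = a / 2 := by field_simp
  rw [mul_add, h7] at h6
  linarith

variable {n : ℕ} {M : Type*} [MetricSpace M] [ChartedSpace (EuclideanSpace ℝ (Fin n)) M]
  [Bundle.RiemannianBundle (fun x : M => TangentSpace (𝓡 n) x)] [IsManifold (𝓡 n) ∞ M]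
  [IsContMDiffRiemannianBundle (𝓡 n) ∞ (EuclideanSpace ℝ (Fin n))
    (fun x : M => TangentSpace (𝓡 n) x)]

/-- Chart segments have finite length, so nearby points always fall under `HasRiemannianDist`, even
on a disconnected manifold. -/
theorem HasRiemannianDist.exists_nhds_edist_le (hM : HasRiemannianDist n M) (p : M) :
    ∃ C : ℝ≥0, ∃ U ∈ 𝓝 p, ∀ x ∈ U, ∀ y ∈ U,
      riemannianEDist (𝓡 n) x y ≠ ⊤ ∧
      dist x y ≤ C * dist (extChartAt (𝓡 n) p x) (extChartAt (𝓡 n) p y) := by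
  have : IsContinuousRiemannianBundle (EuclideanSpace ℝ (Fin n))
    (fun x : M => TangentSpace (𝓡 n) x) := isContinuousRiemannianBundle
  have : IsManifold (𝓡 n) 1 M := IsManifold.of_le (n := ∞) (by simp)
  obtain ⟨C, U, hU, h⟩ := exists_nhds_riemannianEDist_le_edist_extChartAt (𝓡 n) p
  refine ⟨C, U, hU, fun x hx y hy => ?_⟩
  have h1 := h x hx y hy
  have h2 : riemannianEDist (𝓡 n) x y ≠ ⊤ :=
    ne_top_of_le_ne_top (ENNReal.mul_ne_top ENNReal.coe_ne_top (edist_ne_top _ _)) h1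
  refine ⟨h2, ?_⟩
  rw [← hM x y h2, edist_dist, edist_dist, ← ENNReal.ofReal_coe_nnreal,
    ← ENNReal.ofReal_mul (NNReal.coe_nonneg _)] at h1
  exact (ENNReal.ofReal_le_ofReal_iff (by positivity)).1 h1

variable [CompactSpace M]

/-- A smooth embedding of a compact Riemannian manifold is bi-Lipschitz from below. -/
theorem HasRiemannianDist.exists_dist_le_mul_dist (hM : HasRiemannianDist n M) {E : Type*}
    [NormedAddCommGroup E] [NormedSpace ℝ E] {e : M → E} (he : ContMDiff (𝓡 n) 𝓘(ℝ, E) 1 e)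
    (hinj : Injective e) (hinj' : ∀ x, Injective (mfderiv (𝓡 n) 𝓘(ℝ, E) e x)) :
    ∃ A : ℝ, ∀ x y, dist x y ≤ A * dist (e x) (e y) := by
  have : IsManifold (𝓡 n) 1 M := IsManifold.of_le (n := ∞) (by simp)
  obtain ⟨A, hA⟩ := exists_forall_of_locally (Y := M × M)
    (R := fun A p => dist p.1 p.2 ≤ A * dist (e p.1) (e p.2))
    (fun A B p hAB h => h.trans (by gcongr)) (by
      rintro ⟨p, p'⟩
      -- Near the diagonal both distances are compared with a chart; elsewhere injectivity keeps the
      -- images apart.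
      rcases eq_or_ne p p' with rfl | hne
      · obtain ⟨C, U, hU, h1⟩ := hM.exists_nhds_edist_le p
        obtain ⟨K, hK, V, hV, h2⟩ := exists_nhds_dist_extChartAt_le he p (hinj' p)
        refine ⟨C * K, ?_⟩
        filter_upwards [prod_mem_nhds (inter_mem hU hV) (inter_mem hU hV)] with q hq
        calc dist q.1 q.2 ≤ _ := (h1 _ hq.1.1 _ hq.2.1).2
          _ ≤ C * (K * dist (e q.1) (e q.2)) := by
            gcongr
            exact h2 _ hq.1.2 _ hq.2.2
          _ = _ := by ring
      · set m := dist (e p) (e p') with hm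
        have hm0 : 0 < m := dist_pos.2 (hinj.ne hne)
        refine ⟨Metric.diam (univ : Set M) / (m / 2), ?_⟩
        have hc : Continuous fun q : M × M => dist (e q.1) (e q.2) :=
          (he.continuous.comp continuous_fst).dist (he.continuous.comp continuous_snd)
        filter_upwards [hc.continuousAt.eventually (lt_mem_nhds (half_lt_self hm0))] with q hq
        have hd : dist q.1 q.2 ≤ Metric.diam (univ : Set M) :=
          Metric.dist_le_diam_of_mem isCompact_univ.isBounded (mem_univ _) (mem_univ _)
        have hd0 : 0 ≤ Metric.diam (univ : Set M) := Metric.diam_nonneg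
        calc dist q.1 q.2 ≤ Metric.diam (univ : Set M) / (m / 2) * (m / 2) := by
              rwa [div_mul_cancel₀ _ (by positivity)]
          _ ≤ _ := by gcongr)
  exact ⟨A, fun x y => hA (x, y)⟩

theorem COneSpace.abs_apply_le (u : COneSpace n M) (x : M) : |u x| ≤ ‖u‖ := by
  rw [COneSpace.norm_def]
  have h1 : |u x| ≤ ‖u.toC‖ := u.toC.norm_coe_le_norm x
  have h2 : 0 ≤ ⨆ x, ‖differential n u x‖ :=
    Real.iSup_nonneg fun x => ContinuousLinearMap.opNorm_nonneg _
  linarith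

theorem COneSpace.norm_differential_le (u : COneSpace n M) (x : M) :
    ‖differential n u x‖ ≤ ‖u‖ := by
  rw [COneSpace.norm_def]
  exact (le_ciSup u.bddAbove x).trans (le_add_of_nonneg_left (norm_nonneg _))

/-- Continuously differentiable functions are Lipschitz, with a constant controlled by the
norm. -/
theorem HasRiemannianDist.exists_abs_sub_le (hM : HasRiemannianDist n M) :
    ∃ K : ℝ, 0 ≤ K ∧ ∀ (u : COneSpace n M) (x y : M), |u x - u y| ≤ K * ‖u‖ * dist x y := by
  obtain ⟨A, hA⟩ := exists_forall_of_locally (Y := M × M)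
    (R := fun A p => ∀ u : COneSpace n M, |u p.1 - u p.2| ≤ A * ‖u‖ * dist p.1 p.2)
    (fun A B p hAB h u => (h u).trans (by gcongr)) (by
      rintro ⟨p, p'⟩
      -- Near the diagonal the path bound applies; elsewhere the sup norm suffices, including across
      -- components.
      rcases eq_or_ne p p' with rfl | hne
      · obtain ⟨C, U, hU, h1⟩ := hM.exists_nhds_edist_le p
        refine ⟨1, ?_⟩
        filter_upwards [prod_mem_nhds hU hU] with q hq u
        have h2 := (h1 _ hq.1 _ hq.2).1
        have h3 := u.enorm_sub_le (B := ‖u‖₊) u.norm_differential_le q.1 q.2 h2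
        rw [← hM _ _ h2, edist_dist, ← ofReal_norm, ← ENNReal.ofReal_coe_nnreal,
          ← ENNReal.ofReal_mul (NNReal.coe_nonneg _), ENNReal.ofReal_le_ofReal_iff (by positivity)]
          at h3
        rw [abs_sub_comm, one_mul]
        exact h3
      · set m := dist p p' with hm
        have hm0 : 0 < m := dist_pos.2 hne
        refine ⟨2 / (m / 2), ?_⟩
        have hc : Continuous fun q : M × M => dist q.1 q.2 := continuous_dist
        filter_upwards [hc.continuousAt.eventually (lt_mem_nhds (half_lt_self hm0))] with q hq u
        have h1 := u.abs_apply_le q.1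
        have h2 := u.abs_apply_le q.2
        calc |u q.1 - u q.2| ≤ |u q.1| + |u q.2| := abs_sub _ _
          _ ≤ 2 / (m / 2) * ‖u‖ * (m / 2) := by
            have : 2 / (m / 2) * ‖u‖ * (m / 2) = 2 * ‖u‖ := by field_simp
            linarith
          _ ≤ _ := by gcongr)
  refine ⟨max A 0, le_max_right _ _, fun u x y => (hA (x, y) u).trans ?_⟩
  gcongr
  exact le_max_left _ _

/-- A continuously differentiable function, as an element of `C^{1,0}(M)`. -/
def COneSpace.mk {n : ℕ} {M : Type*} [TopologicalSpace M]
    [ChartedSpace (EuclideanSpace ℝ (Fin n)) M] (u : M → ℝ)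
    (hu : ContMDiff (𝓡 n) 𝓘(ℝ, ℝ) 1 u) : COneSpace n M :=
  (⟨⟨u, hu.continuous⟩, hu⟩ : cOneSubmodule n M)

theorem euclidean_norm_le_sum {N : ℕ} (w : EuclideanSpace ℝ (Fin N)) : ‖w‖ ≤ ∑ j, |w j| := by
  conv_lhs => rw [← (EuclideanSpace.basisFun (Fin N) ℝ).sum_repr w]
  refine (norm_sum_le _ _).trans (Finset.sum_le_sum fun j _ => ?_)
  rw [norm_smul, (EuclideanSpace.basisFun (Fin N) ℝ).norm_eq_one, mul_one]
  simp

/-- The differentials of `g ∘ e`, for `g` with Lipschitz constant `1`, are uniformly bounded. -/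
theorem exists_norm_differential_comp_le {N : ℕ} {e : M → EuclideanSpace ℝ (Fin N)}
    (he : ContMDiff (𝓡 n) 𝓘(ℝ, EuclideanSpace ℝ (Fin N)) 1 e) :
    ∃ B : ℝ, 0 ≤ B ∧ ∀ g : EuclideanSpace ℝ (Fin N) → ℝ, ContDiff ℝ 1 g → LipschitzWith 1 g →
      ∀ x, ‖differential n (g ∘ e) x‖ ≤ B := by
  have hej : ∀ j, ContMDiff (𝓡 n) 𝓘(ℝ, ℝ) 1 fun x => e x j := fun j =>
    (EuclideanSpace.proj (𝕜 := ℝ) j).contMDiff.comp he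
  -- The coordinates of `e` are C^1 functions, whose norms bound the differential of `e` uniformly.
  set E : Fin N → COneSpace n M := fun j => COneSpace.mk _ (hej j)
  refine ⟨∑ j, ‖E j‖, by positivity, fun g hg hgL x => ?_⟩
  refine ContinuousLinearMap.opNorm_le_bound _ (by positivity) fun v => ?_
  have hed := he.mdifferentiable one_ne_zero x
  set w : EuclideanSpace ℝ (Fin N) := mfderiv (𝓡 n) 𝓘(ℝ, EuclideanSpace ℝ (Fin N)) e x v with hw
  have h1 : differential n (g ∘ e) x v = fderiv ℝ g (e x) w := by
    unfold differential
    rw [mfderiv_comp x (hg.contMDiff.mdifferentiable one_ne_zero _) hed, mfderiv_eq_fderiv]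
    rfl
  have h2 : ∀ j, differential n (E j) x v = w j := by
    intro j
    have : ((E j : COneSpace n M) : M → ℝ) = EuclideanSpace.proj (𝕜 := ℝ) j ∘ e := rfl
    unfold differential
    rw [this, mfderiv_comp x
      ((EuclideanSpace.proj (𝕜 := ℝ) j).contMDiff.mdifferentiable one_ne_zero _) hed,
      ContinuousLinearMap.mfderiv_eq]
    rfl
  calc ‖differential n (g ∘ e) x v‖ = ‖fderiv ℝ g (e x) w‖ := congrArg norm h1
    _ ≤ ‖fderiv ℝ g (e x)‖ * ‖w‖ := ContinuousLinearMap.le_opNorm _ _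
    _ ≤ 1 * ‖w‖ := by
      gcongr
      exact norm_fderiv_le_of_lipschitz ℝ hgL
    _ ≤ ∑ j, |w j| := by rw [one_mul]; exact euclidean_norm_le_sum w
    _ ≤ ∑ j, ‖E j‖ * ‖v‖ := by
      refine Finset.sum_le_sum fun j _ => ?_
      rw [← h2 j]
      exact (ContinuousLinearMap.le_opNorm (differential n (E j) x) v).trans
        (mul_le_mul_of_nonneg_right ((E j).norm_differential_le x) (norm_nonneg v))
    _ = (∑ j, ‖E j‖) * ‖v‖ := by rw [Finset.sum_mul]

end ManifoldBounds

/-! ### Density and openness in the C^1 space. -/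

section COneDensity

open Filter Topology Set Function Manifold

variable {n : ℕ} {M : Type*} [MetricSpace M] [ChartedSpace (EuclideanSpace ℝ (Fin n)) M]
  [Bundle.RiemannianBundle (fun x : M => TangentSpace (𝓡 n) x)] [IsManifold (𝓡 n) ∞ M]
  [IsContMDiffRiemannianBundle (𝓡 n) ∞ (EuclideanSpace ℝ (Fin n))
    (fun x : M => TangentSpace (𝓡 n) x)] [CompactSpace M]

/-- On a compact Riemannian manifold, the distance to a nonempty set is comparable, up to a small
error on that set, to functions in a bounded subset of `C^{1,0}(M)`. -/
theorem HasRiemannianDist.exists_cOne_bump (hM : HasRiemannianDist n M) :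
    ∃ A R : ℝ, 0 < A ∧ 0 ≤ R ∧ ∀ (S : Set M), S.Nonempty → ∀ τ : ℝ, 0 < τ → τ ≤ 1 →
      ∃ h : COneSpace n M, ‖h‖ ≤ R ∧ (∀ x, Metric.infDist x S ≤ A * (h x + τ)) ∧
        ∀ x ∈ S, h x ≤ τ := by
  -- An embedding transfers the problem to Euclidean distance, which can be mollified with a
  -- Lipschitz constant independent of S and τ.
  obtain ⟨N, e, he, hemb, hinj⟩ := exists_embedding_euclidean_of_compact (I := 𝓡 n) (M := M)
  have he1 : ContMDiff (𝓡 n) 𝓘(ℝ, EuclideanSpace ℝ (Fin N)) 1 e := he.of_le (by simp)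
  obtain ⟨A, hA⟩ := hM.exists_dist_le_mul_dist he1 hemb.injective hinj
  obtain ⟨B, hB0, hB⟩ := exists_norm_differential_comp_le he1
  set D : ℝ := Metric.diam (range e) with hD
  have hbd : Bornology.IsBounded (range e) := (isCompact_range hemb.continuous).isBounded
  have hD0 : 0 ≤ D := Metric.diam_nonneg
  have hA1 : 0 < max A 1 := lt_max_of_lt_right one_pos
  refine ⟨max A 1, D + 1 + B, hA1, by positivity, fun S hS τ hτ hτ1 => ?_⟩
  have hS' : (e '' S).Nonempty := hS.image e
  obtain ⟨g, hg, hgL, hgτ⟩ :=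
    (Metric.lipschitz_infDist_pt (e '' S)).exists_contDiff_approx hτ
  set h : COneSpace n M := COneSpace.mk (g ∘ e) (hg.contMDiff.comp he1) with hh
  refine ⟨h, ?_, fun x => ?_, fun x hx => ?_⟩
  · rw [COneSpace.norm_def]
    refine add_le_add ((ContinuousMap.norm_le _ (by positivity)).2 fun x => ?_)
      (Real.iSup_le (fun x => hB g hg hgL x) hB0)
    have h1 := abs_le.1 (hgτ (e x))
    obtain ⟨s, hs⟩ := hS
    have h2 : Metric.infDist (e x) (e '' S) ≤ D :=
      (Metric.infDist_le_dist_of_mem (mem_image_of_mem e hs)).trans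
        (Metric.dist_le_diam_of_mem hbd (mem_range_self _) (mem_range_self _))
    have h3 : 0 ≤ Metric.infDist (e x) (e '' S) := Metric.infDist_nonneg
    change |g (e x)| ≤ _
    rw [abs_le]
    constructor <;> linarith [h1.1, h1.2]
  · have h1 := (abs_le.1 (hgτ (e x))).1
    change _ ≤ max A 1 * (g (e x) + τ)
    have h2 : Metric.infDist x S / max A 1 ≤ Metric.infDist (e x) (e '' S) := by
      refine (Metric.le_infDist hS').2 ?_
      rintro _ ⟨s, hs, rfl⟩
      rw [div_le_iff₀' hA1]
      refine (Metric.infDist_le_dist_of_mem hs).trans ((hA x s).trans ?_)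
      gcongr
      exact le_max_left _ _
    rw [div_le_iff₀' hA1] at h2
    refine h2.trans ?_
    gcongr
    linarith
  · have h1 := (abs_le.1 (hgτ (e x))).2
    rw [Metric.infDist_zero_of_mem (mem_image_of_mem e hx)] at h1
    change g (e x) ≤ τ
    linarith

variable [MeasurableSpace M] [BorelSpace M]

theorem IsAdmissible.exists_dense_cOne (hM : HasRiemannianDist n M) {X : Set M} [CompactSpace X]
    [Nonempty X] {T : X → X} {ψ : M → ℝ} (hψ : MemHolder 1 ψ)
    (h : IsAdmissible T (fun x : X => ψ x)) :
    ∃ P : Set (COneSpace n M), IsOpen P ∧ Dense P ∧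
      ∀ u ∈ P, UniquelyPeriodicallyMinimized T (fun x : X => u x) (fun x : X => ψ x) := by
  obtain ⟨A, R, hA, hR, hbump⟩ := hM.exists_cOne_bump
  obtain ⟨K, hK, hKu⟩ := hM.exists_abs_sub_le
  have hKX : ∀ (u : COneSpace n M) (x y : X),
      |u x - u y| ≤ K * ‖u‖ * dist x y ^ ((1 : ℝ≥0) : ℝ) := fun u x y => by
    rw [NNReal.coe_one, Real.rpow_one]
    exact hKu u x y
  have hψX : MemHolder 1 (fun x : X => ψ x) := by
    obtain ⟨C, hC⟩ := hψ
    exact ⟨C, fun x y => hC x y⟩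
  refine ⟨interior {u | UniquelyPeriodicallyMinimized T (fun x : X => u x) (fun x : X => ψ x)},
    isOpen_interior, ?_, fun u hu => (interior_subset hu : u ∈ {u : COneSpace n M | _})⟩
  rw [Metric.dense_iff]
  intro u r hr
  -- Since R bounds all bumps, ε can be chosen before the orbit.
  set ε : ℝ := r / (2 * (R + 1)) with hε
  have hε0 : 0 < ε := by positivity
  have hεR : ε * R ≤ r / 2 := by
    rw [hε, div_mul_eq_mul_div, div_le_iff₀ (by positivity)]
    nlinarith
  obtain ⟨z, -, c, hc, hz⟩ := h.exists_orbit_uniquely_minimizing one_pos le_rfl hψX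
    (HolderWith.of_abs_sub_le (by positivity) (hKX u)).memHolder
    (show 0 < ε / A by positivity) (show 0 ≤ K * (r / 2 + 1) by positivity)
  set O := orbit T z with hO
  -- Smoothing uses half of the margin c; the other half is left for the open ball.
  set τ : ℝ := min 1 (c / (2 * ε)) with hτ
  have hτ0 : 0 < τ := by positivity
  have hετ : ε * τ ≤ c / 2 := by
    calc ε * τ ≤ ε * (c / (2 * ε)) := by gcongr; exact min_le_right _ _
      _ = c / 2 := by field_simp
  obtain ⟨b, hb, hbS, hbO⟩ := hbump ((↑) '' O) ((range_nonempty _).image _) τ hτ0 (min_le_left _ _)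
  have hεb : ‖ε • b‖ ≤ r / 2 := by
    rw [COneSpace.core.norm_smul, Real.norm_of_nonneg hε0.le]
    exact le_trans (by gcongr) hεR
  have happ : ∀ x, (ε • b) x = ε * b x := fun _ => rfl
  refine ⟨u + ε • b, ?_, mem_interior.2 ⟨Metric.ball (u + ε • b) (min (c / 2) 1), ?_,
    Metric.isOpen_ball, Metric.mem_ball_self (by positivity)⟩⟩
  · rw [Metric.mem_ball, dist_eq_norm, add_sub_cancel_left]
    exact hεb.trans_lt (half_lt_self hr)
  · intro u' hu'
    rw [Metric.mem_ball, dist_eq_norm] at hu'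
    set w := u' - (u + ε • b) with hw
    have hwc : ‖w‖ ≤ c / 2 := hu'.le.trans (min_le_left _ _)
    have hw1 : ‖w‖ ≤ 1 := hu'.le.trans (min_le_right _ _)
    have hnorm : ‖ε • b + w‖ ≤ r / 2 + 1 := (norm_add_le _ _).trans (add_le_add hεb hw1)
    have hadd : ∀ x, (ε • b + w) x = ε * b x + w x := fun _ => rfl
    have key := hz (fun x => (ε • b + w) x) ?_ ?_ ?_
    · have h1 : u' = u + (ε • b + w) := by rw [hw]; abel
      rw [mem_ofPred_eq, h1]
      exact key
    · intro x y
      refine (hKX (ε • b + w) x y).trans ?_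
      gcongr
    · intro x
      have h1 := (abs_le.1 ((w.abs_apply_le x).trans hwc)).1
      have h2 := hbS x
      rw [Metric.infDist_image isometry_subtype_coe] at h2
      have h3 : ε / A * Metric.infDist x O ≤ ε * (b x + τ) := by
        calc ε / A * Metric.infDist x O ≤ ε / A * (A * (b x + τ)) := by gcongr
          _ = _ := by field_simp
      rw [NNReal.coe_one, Real.rpow_one, hadd]
      linarith
    · intro y hy
      have h1 := (abs_le.1 ((w.abs_apply_le y).trans hwc)).2
      have h2 : ε * b y ≤ ε * τ := by
        have := hbO y (mem_image_of_mem _ hy)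
        gcongr
      rw [hadd]
      linarith

end COneDensity

end ErgOpt

theorem theorem2p1 :
    -- Part I: Hölder observables
    (∀ (X : Type*) [MetricSpace X] [CompactSpace X] [Nonempty X] [MeasurableSpace X]
        [BorelSpace X] (T : X → X) (ψ : X → ℝ), ErgOpt.IsAdmissible T ψ →
      ∀ α : ℝ≥0, 0 < α → α ≤ 1 → MemHolder α ψ →
        ∃ P : Set (ErgOpt.HolderSpace X α), IsOpen P ∧ Dense P ∧
          ∀ u ∈ P, ErgOpt.UniquelyPeriodicallyMinimized T u ψ) ∧
    -- Part II: `C^1` observables on an ambient compact smooth Riemannian manifold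
    (∀ (n : ℕ) (M : Type*) [MetricSpace M] [CompactSpace M] [MeasurableSpace M] [BorelSpace M]
        [ChartedSpace (EuclideanSpace ℝ (Fin n)) M] [IsManifold (𝓡 n) ∞ M]
        [Bundle.RiemannianBundle (fun x : M => TangentSpace (𝓡 n) x)]
        [IsContMDiffRiemannianBundle (𝓡 n) ∞ (EuclideanSpace ℝ (Fin n))
          (fun x : M => TangentSpace (𝓡 n) x)],
      ErgOpt.HasRiemannianDist n M →
      ∀ (X : Set M) [CompactSpace X] [Nonempty X] (f : M → M) (T : X → X) (ψ : M → ℝ),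
        Continuous f → (∀ x : X, (T x : M) = f x) → MemHolder 1 ψ →
        ErgOpt.IsAdmissible T (fun x : X => ψ x) →
          ∃ P : Set (ErgOpt.COneSpace n M), IsOpen P ∧ Dense P ∧
            ∀ u ∈ P, ErgOpt.UniquelyPeriodicallyMinimized T (fun x : X => u x)
              (fun x : X => ψ x)) :=
  ⟨fun _ _ _ _ _ _ _ _ h _ hα hα1 hψ => h.exists_dense_holder hα hα1 hψ,
    fun _ _ _ _ _ _ _ _ _ _ hM _ _ _ _ _ _ _ _ hψ h => h.exists_dense_cOne hM hψ⟩
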